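/- Let $n\ge 2$, let $U\subset\mathbb{R}^n$ be open and connected, let $b=(b_1,\dots,b_n):U\to\mathbb{R}^n$ be smooth, and put $\beta(x,y)=\sum_k y^k b_k(x)$. On the slit tangent bundle $\mathcal{T}U=U\times(\mathbb{R}^n\setminus\{0\})$ consider the one form deformation $S=S_0-2\beta\,\mathcal{C}$ of the flat spray $S_0=y^i\frac{\partial}{\partial x^i}$, where $\mathcal{C}=y^i\frac{\partial}{\partial y^i}$. Write $S=y^i\frac{\partial}{\partial x^i}-2G^i\frac{\partial}{\partial y^i}$ (so $G^i=\beta y^i$), $N^i_j=\partial G^i/\partial y^j$, let $\Phi=R^i_j\,\frac{\partial}{\partial y^i}\otimes dx^j$ with $R^i_j=2\frac{\partial G^i}{\partial x^j}-S(N^i_j)-N^i_kN^k_j$ be its Jacobi endomorphism and $\mathrm{Ric}=R^i_i$ its Ricci curvature. A Finsler function on $U$ is a function $F:U\times\mathbb{R}^n\to\mathbb{R}$ that is smooth and strictly positive on $\mathcal{T}U$, zero at $y=0$, positively $1$-homogeneous in $y$, and such that the matrix $\big(\partial^2E/\partial y^i\partial y^j\big)$, $E=\frac12F^2$, has rank $n$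 on $\mathcal{T}U$. The spray $S$ is Finsler metrizable if it is the geodesic spray of some Finsler function $F$ on $U$, that is, $i_Sdd_JE=d(E-\mathcal{L}_{\mathcal C}E)$ on $\mathcal{T}U$, where $J=\frac{\partial}{\partial y^i}\otimes dx^i$ and $d_JE=dE\circ J$; then $F$ has constant flag curvature $\kappa$ if $\Phi=\kappa\,(F^2J-F\,d_JF\otimes\mathcal{C})$ on $\mathcal{T}U$. Consider the condition $(\ast)$ there are constants $c_{ij}=c_{ji}$, $c'=(c_1,\dots,c_n)$ and $c$ such that $c_{ij}x^ix^j+\langle c',x\rangle+c\neq 0$ on $U$ and $$b_k(x)=-\frac{2c_{ik}x^i+c_k}{2\,(c_{ij}x^ix^j+\langle c',x\rangle+c)}\qquad (x\in U,\ 1\le k\le n).$$ Then: 1. If $\mathrm{Ric}$ has no zero on $\mathcal{T}U$, then $S$ is Finsler metrizable if and only if $(\ast)$ holds. 2. $S$ is metrizable by a Finsler function of nonzero constant flag curvature if and only if $\mathrm{Ric}$ has no zero on $\mathcal{T}U$ and $(\ast)$ holds. 3. If $S$ is Finsler metrizable (with no assumption on $\mathrm{Ric}$), then $(\ast)$ holds.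 -/

import Mathlib

open scoped ContDiff

noncomputable section

/-- Points, tangent vectors and covectors of `ℝⁿ`, in the standard coordinates. -/
abbrev Vec (n : ℕ) : Type := Fin n → ℝ

/-- The tangent bundle of `ℝⁿ`, with coordinates `(x, y)`. Tangent vectors to it are again pairs:
the pair `(u, v)` stands for `uⁱ ∂/∂xⁱ + vⁱ ∂/∂yⁱ`. -/
abbrev TBundle (n : ℕ) : Type := Vec n × Vec n

/-- The nonzero tangent vectors over `U`. -/
def slitBundle {n : ℕ} (U : Set (Vec n)) : Set (TBundle n) :=
  {p | p.1 ∈ U ∧ p.2 ≠ 0}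

/-- The partial derivative `∂f/∂xⁱ`. -/
def pdx {n : ℕ} (i : Fin n) (f : TBundle n → ℝ) (p : TBundle n) : ℝ :=
  fderiv ℝ f p (Pi.single i 1, 0)

/-- The partial derivative `∂f/∂yⁱ`. -/
def pdy {n : ℕ} (i : Fin n) (f : TBundle n → ℝ) (p : TBundle n) : ℝ :=
  fderiv ℝ f p (0, Pi.single i 1)

/-- The natural almost-tangent structure `J = ∂/∂yⁱ ⊗ dxⁱ`. -/
def almostTangent (n : ℕ) : TBundle n →L[ℝ] TBundle n :=
  (ContinuousLinearMap.inr ℝ (Vec n) (Vec n)).comp (ContinuousLinearMap.fst ℝ (Vec n) (Vec n))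

/-- The Liouville vector field `C = yⁱ ∂/∂yⁱ`. -/
def liouville {n : ℕ} (p : TBundle n) : TBundle n := (0, p.2)

/-- `S` is a spray over `U`: a smooth vector field on the slit tangent bundle with `J S = C` and
`[C, S] = S`. -/
structure IsSpray {n : ℕ} (U : Set (Vec n)) (S : TBundle n → TBundle n) : Prop where
  smooth : ContDiffOn ℝ ∞ S (slitBundle U)
  almostTangent_eq : ∀ p ∈ slitBundle U, almostTangent n (S p) = liouville p
  lieBracket_eq : ∀ p ∈ slitBundle U, VectorField.lieBracket ℝ liouville S p = S p

/-- The coefficients `Gⁱ` of a spray `S = yⁱ ∂/∂xⁱ - 2 Gⁱ ∂/∂yⁱ`. -/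
def sprayCoeff {n : ℕ} (S : TBundle n → TBundle n) (i : Fin n) (p : TBundle n) : ℝ :=
  -((S p).2 i) / 2

/-- The coefficients `Nⁱⱼ = ∂Gⁱ/∂yʲ` of the canonical nonlinear connection of a spray. -/
def connCoeff {n : ℕ} (S : TBundle n → TBundle n) (i j : Fin n) (p : TBundle n) : ℝ :=
  pdy j (sprayCoeff S i) p

/-- The components `Rⁱⱼ = 2 ∂Gⁱ/∂xʲ - S(Nⁱⱼ) - Nⁱₖ Nᵏⱼ` of the Jacobi endomorphism
`Φ = Rⁱⱼ ∂/∂yⁱ ⊗ dxʲ` of a spray. -/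
def jacobiEndo {n : ℕ} (S : TBundle n → TBundle n) (p : TBundle n) : Matrix (Fin n) (Fin n) ℝ :=
  Matrix.of fun i j =>
    2 * pdx j (sprayCoeff S i) p - fderiv ℝ (connCoeff S i j) p (S p)
      - ∑ k, connCoeff S i k p * connCoeff S k j p

/-- The Ricci curvature, the trace of the Jacobi endomorphism. -/
def ricciCurv {n : ℕ} (S : TBundle n → TBundle n) (p : TBundle n) : ℝ :=
  (jacobiEndo S p).trace

/-- The Ricci curvature of `S` has no zero on the slit tangent bundle over `U`. -/
def RicciNonvanishing {n : ℕ} (U : Set (Vec n)) (S : TBundle n → TBundle n) : Prop :=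
  ∀ p ∈ slitBundle U, ricciCurv S p ≠ 0

/-- The energy `E = F² / 2`. -/
def energy {n : ℕ} (F : TBundle n → ℝ) (p : TBundle n) : ℝ := F p ^ 2 / 2

/-- The metric tensor `gᵢⱼ = ∂²E/∂yⁱ∂yʲ`. -/
def metricTensor {n : ℕ} (F : TBundle n → ℝ) (p : TBundle n) : Matrix (Fin n) (Fin n) ℝ :=
  Matrix.of fun i j => pdy i (pdy j (energy F)) p

/-- `F` is a Finsler function on `U` (only its values on the tangent bundle of `U` matter). -/
structure IsFinsler {n : ℕ} (U : Set (Vec n)) (F : TBundle n → ℝ) : Prop where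
  smooth : ContDiffOn ℝ ∞ F (slitBundle U)
  pos : ∀ p ∈ slitBundle U, 0 < F p
  zero : ∀ x ∈ U, F (x, 0) = 0
  homog : ∀ p ∈ slitBundle U, ∀ t : ℝ, 0 < t → F (p.1, t • p.2) = t * F p
  rank_eq : ∀ p ∈ slitBundle U, (metricTensor F p).rank = n

/-- The semi-basic one-form `d_J E = dE ∘ J`. -/
def dJ {n : ℕ} (E : TBundle n → ℝ) (p : TBundle n) : TBundle n →L[ℝ] ℝ :=
  (fderiv ℝ E p).comp (almostTangent n)

/-- The exterior derivative `dθ(v, w) = (D_v θ)(w) - (D_w θ)(v)` of a one-form `θ`. -/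
def extD {n : ℕ} (θ : TBundle n → TBundle n →L[ℝ] ℝ) (p v w : TBundle n) : ℝ :=
  fderiv ℝ θ p v w - fderiv ℝ θ p w v

/-- The Euler-Lagrange form `ω_E = i_S d d_J E - d (E - L_C E)`. -/
def eulerLagrangeForm {n : ℕ} (S : TBundle n → TBundle n) (E : TBundle n → ℝ)
    (p w : TBundle n) : ℝ :=
  extD (dJ E) p (S p) w - fderiv ℝ (fun q => E q - fderiv ℝ E q (liouville q)) p w

/-- `S` is the geodesic spray of the Finsler function `F` over `U`. -/
def IsGeodesicSpray {n : ℕ} (U : Set (Vec n)) (F : TBundle n → ℝ)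
    (S : TBundle n → TBundle n) : Prop :=
  IsSpray U S ∧ ∀ p ∈ slitBundle U, ∀ w, eulerLagrangeForm S (energy F) p w = 0

/-- `S` is Finsler metrizable over `U`. -/
def FinslerMetrizable {n : ℕ} (U : Set (Vec n)) (S : TBundle n → TBundle n) : Prop :=
  ∃ F : TBundle n → ℝ, IsFinsler U F ∧ IsGeodesicSpray U F S

/-- A Finsler function `F` with geodesic spray `S` has constant flag curvature `κ`:
`Φ = κ (F² J - F d_J F ⊗ C)`. -/
def HasConstFlagCurvature {n : ℕ} (U : Set (Vec n)) (F : TBundle n → ℝ)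
    (S : TBundle n → TBundle n) (κ : ℝ) : Prop :=
  ∀ p ∈ slitBundle U, ∀ i j : Fin n,
    jacobiEndo S p i j =
      κ * (F p ^ 2 * (1 : Matrix (Fin n) (Fin n) ℝ) i j - F p * pdy j F p * p.2 i)

/-- `S` is metrizable over `U` by a Finsler function of nonzero constant flag curvature. -/
def MetrizableNonzeroConstCurvature {n : ℕ} (U : Set (Vec n))
    (S : TBundle n → TBundle n) : Prop :=
  ∃ (F : TBundle n → ℝ) (κ : ℝ), IsFinsler U F ∧ IsGeodesicSpray U F S ∧ κ ≠ 0 ∧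
    HasConstFlagCurvature U F S κ

/-- The flat spray `S₀ = yⁱ ∂/∂xⁱ`. -/
def flatSpray {n : ℕ} (p : TBundle n) : TBundle n := (p.2, 0)

/-- The one-form with components `b`, as the function `β(x, y) = yᵏ bₖ(x)`. -/
def oneFormFun {n : ℕ} (b : Vec n → Vec n) (p : TBundle n) : ℝ := ∑ k, p.2 k * b p.1 k

/-- The one form deformation `S = S₀ - 2 β C` of the flat spray. -/
def oneFormDeformation {n : ℕ} (b : Vec n → Vec n) (p : TBundle n) : TBundle n :=
  flatSpray p - (2 * oneFormFun b p) • liouville p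

/-- The quadratic function `h(x) = cᵢⱼ xⁱ xʲ + ⟨c', x⟩ + c`. -/
def quadFun {n : ℕ} (C : Matrix (Fin n) (Fin n) ℝ) (c' : Vec n) (c : ℝ) (x : Vec n) : ℝ :=
  ∑ i, ∑ j, C i j * x i * x j + ∑ i, c' i * x i + c

/-- On `U`, `bₖ(x) = -(2 cᵢₖ xⁱ + cₖ) / (2 h(x))` for some constants `cᵢⱼ = cⱼᵢ`, `cₖ`, `c` for
which the denominator has no zero on `U`. -/
def HasQuadraticForm {n : ℕ} (U : Set (Vec n)) (b : Vec n → Vec n) : Prop :=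
  ∃ (C : Matrix (Fin n) (Fin n) ℝ) (c' : Vec n) (c : ℝ), C.IsSymm ∧
    (∀ x ∈ U, quadFun C c' c x ≠ 0) ∧
    ∀ x ∈ U, ∀ k, b x k = -(2 * ∑ i, C i k * x i + c' k) / (2 * quadFun C c' c x)

end

/-!
Write `B x` for the covector `b(x)`, `β = B(y)`, `E = F² / 2`, and `A(v, y)` for the bilinear form
`curvForm`, through which the Jacobi endomorphism of the deformed spray is `A(y, y) J - A(·, y) ⊗ C`
and its Ricci curvature `(n - 1) A(y, y)`.

Suppose `E` is the energy of a Finsler function with this spray. With Euler's identity the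
Euler-Lagrange equation becomes the first-order system `∂E/∂xᵛ = β ∂E/∂yᵛ + 2 B(v) E`
(`IsHorizontallyConstant`), whose integrability condition is `A(y, y) ∂E/∂yᵛ = 2 A(v, y) E`
(`IsHorizontallyConstant.curvForm_identity`). On a single fibre this identity already forces `A` to
be symmetric, and either zero or without nonzero isotropic vectors. An isotropic vector makes `A` a
rank one form, which must vanish (`bilin_eq_zero_of_isotropic`). Without isotropic vectors,
`E / A(y, y)` is zero-homogeneous and has a critical point on the compact sphere, where the
antisymmetric part of `A` degenerates (`bilin_symm_of_anisotropic`). This is where it matters that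
`E` is positive and smooth on the whole punctured fibre.

Symmetry of `A` means that `b` is closed, and then `A = a`, with `a = B ⊗ B - ∂B` (`deformForm`).
Differentiating the identity along the base gives, where `a` is anisotropic, the third-order
equation `∂_u a(v, w) = B(v) a(u, w) + B(w) a(u, v) + 2 B(u) a(v, w)` (`IsDeformParallelAt`); it
holds trivially where `a` vanishes locally, so by continuity it holds on all of `U`
(`IsHorizontallyConstant.closed_and_parallel`). If locally `B = -dh / (2 h)`, this equation says that
`h` is quadratic. No simple connectivity is needed to find `h` globally: with
`h_x(z) = 1 - 2 B(d) + B(d)² + a(d, d)`, `d = z - x`, everything on the right taken at `x`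
(`osculatingQuad`), each `x ↦ h_x(z)` solves the linear equation `∂f = 2 f B`, so all the `h_x` are
proportional to one of them, `h_{x₀}` (`osculatingQuad_eq_mul`), which serves as `h`.

Conversely, if `B = -dh / (2 h)` with `h` quadratic, then `b` is closed and `a` satisfies the
third-order equation, which makes `a(y, y)` a solution of the first-order system. If the Ricci
curvature has no zero, `a` is definite with a constant sign `s` on the connected set `U`, and
`F = √(s a(y, y))` (`curvFinsler`) is a Riemannian norm with geodesic spray `S` and flag
curvature `s`.
-/

open Filter Topology Set

/-! ### Derivatives along lines -/

section LineDeriv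

variable {W : Type*} [NormedAddCommGroup W] [NormedSpace ℝ W] {f g : W → ℝ} {f' g' : ℝ} {p w : W}

theorem HasLineDerivAt.mul_real (hf : HasLineDerivAt ℝ f f' p w)
    (hg : HasLineDerivAt ℝ g g' p w) :
    HasLineDerivAt ℝ (fun q => f q * g q) (f' * g p + f p * g') p w := by
  have := HasDerivAt.mul hf hg
  simp only [zero_smul, add_zero] at this
  exact this

theorem HasLineDerivAt.add_real (hf : HasLineDerivAt ℝ f f' p w)
    (hg : HasLineDerivAt ℝ g g' p w) : HasLineDerivAt ℝ (fun q => f q + g q) (f' + g') p w :=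
  HasDerivAt.add hf hg

theorem HasLineDerivAt.sub_real (hf : HasLineDerivAt ℝ f f' p w)
    (hg : HasLineDerivAt ℝ g g' p w) : HasLineDerivAt ℝ (fun q => f q - g q) (f' - g') p w :=
  HasDerivAt.sub hf hg

theorem HasLineDerivAt.const_mul_real (c : ℝ) (hf : HasLineDerivAt ℝ f f' p w) :
    HasLineDerivAt ℝ (fun q => c * f q) (c * f') p w :=
  HasDerivAt.const_mul c hf

/-- An identity that holds on an open set may be differentiated along any line. -/
theorem HasLineDerivAt.eq_of_eqOn {s : Set W} (hs : IsOpen s) (hp : p ∈ s)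
    (h : ∀ q ∈ s, f q = g q) (hf : HasLineDerivAt ℝ f f' p w) (hg : HasLineDerivAt ℝ g g' p w) :
    f' = g' := by
  have hfg : f =ᶠ[𝓝 p] g := by
    filter_upwards [hs.mem_nhds hp] with q hq using h q hq
  exact (hfg.hasLineDerivAt_iff.1 hf).unique hg

end LineDeriv

section ProductLineDeriv

variable {V : Type*} [NormedAddCommGroup V] [NormedSpace ℝ V]
  {E : V × V → ℝ} {B : V → V →L[ℝ] ℝ} {p : V × V}

theorem ContDiffAt.hasLineDerivAt_self (hE : ContDiffAt ℝ 2 E p) (w : V × V) :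
    HasLineDerivAt ℝ E (fderiv ℝ E p w) p w :=
  (hE.differentiableAt (by norm_num)).hasFDerivAt.hasLineDerivAt w

theorem ContDiffAt.hasFDerivAt_fderiv {W X : Type*} [NormedAddCommGroup W] [NormedSpace ℝ W]
    [NormedAddCommGroup X] [NormedSpace ℝ X] {f : W → X} {q : W} (hf : ContDiffAt ℝ 2 f q) :
    HasFDerivAt (fderiv ℝ f) (fderiv ℝ (fderiv ℝ f) q) q :=
  ((hf.fderiv_right (m := 1) (by norm_num)).differentiableAt (by norm_num)).hasFDerivAt

theorem ContDiffAt.fderiv_fderiv_comm {W X : Type*} [NormedAddCommGroup W] [NormedSpace ℝ W]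
    [NormedAddCommGroup X] [NormedSpace ℝ X] {f : W → X} {q : W} (hf : ContDiffAt ℝ 2 f q)
    (u v : W) : fderiv ℝ (fderiv ℝ f) q u v = fderiv ℝ (fderiv ℝ f) q v u :=
  (hf.isSymmSndFDerivAt (by simp)).eq u v

theorem ContDiffAt.hasLineDerivAt_fderiv_apply {W : Type*} [NormedAddCommGroup W]
    [NormedSpace ℝ W] {f : W → ℝ} {q : W} (hf : ContDiffAt ℝ 2 f q) (w v : W) :
    HasLineDerivAt ℝ (fun q => fderiv ℝ f q v) (fderiv ℝ (fderiv ℝ f) q w v) q w := by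
  have := (hf.hasFDerivAt_fderiv.clm_apply (hasFDerivAt_const v q)).hasLineDerivAt w
  simpa using this

theorem ContDiffAt.hasLineDerivAt_fderiv_fibre (hE : ContDiffAt ℝ 2 E p) (w : V × V) :
    HasLineDerivAt ℝ (fun q => fderiv ℝ E q (0, q.2))
      (fderiv ℝ (fderiv ℝ E) p w (0, p.2) + fderiv ℝ E p (0, w.2)) p w := by
  have h2 : HasFDerivAt (fun q : V × V => ((0 : V), q.2))
      ((ContinuousLinearMap.inr ℝ V V).comp (ContinuousLinearMap.snd ℝ V V)) p :=
    ((ContinuousLinearMap.inr ℝ V V).comp (ContinuousLinearMap.snd ℝ V V)).hasFDerivAt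
  have := (hE.hasFDerivAt_fderiv.clm_apply h2).hasLineDerivAt w
  simpa [add_comm] using this

theorem ContDiffAt.hasLineDerivAt_fderiv_base (hE : ContDiffAt ℝ 2 E p) (w : V × V) :
    HasLineDerivAt ℝ (fun q => fderiv ℝ E q (q.2, 0))
      (fderiv ℝ (fderiv ℝ E) p w (p.2, 0) + fderiv ℝ E p (w.2, 0)) p w := by
  have h2 : HasFDerivAt (fun q : V × V => (q.2, (0 : V)))
      ((ContinuousLinearMap.inl ℝ V V).comp (ContinuousLinearMap.snd ℝ V V)) p :=
    ((ContinuousLinearMap.inl ℝ V V).comp (ContinuousLinearMap.snd ℝ V V)).hasFDerivAt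
  have := (hE.hasFDerivAt_fderiv.clm_apply h2).hasLineDerivAt w
  simpa [add_comm] using this

theorem HasFDerivAt.comp_prod_fst {X : Type*} [NormedAddCommGroup X] [NormedSpace ℝ X]
    {f : V → X} {f' : V →L[ℝ] X} (hf : HasFDerivAt f f' p.1) :
    HasFDerivAt (fun q : V × V => f q.1) (f'.comp (ContinuousLinearMap.fst ℝ V V)) p :=
  HasFDerivAt.comp p hf hasFDerivAt_fst

theorem DifferentiableAt.hasLineDerivAt_fst_apply (hB : DifferentiableAt ℝ B p.1) (w : V × V)
    (v : V) : HasLineDerivAt ℝ (fun q : V × V => B q.1 v) (fderiv ℝ B p.1 w.1 v) p w := by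
  have := (hB.hasFDerivAt.comp_prod_fst.clm_apply (hasFDerivAt_const v p)).hasLineDerivAt w
  simpa using this

theorem DifferentiableAt.hasLineDerivAt_fst_apply_snd (hB : DifferentiableAt ℝ B p.1)
    (w : V × V) : HasLineDerivAt ℝ (fun q : V × V => B q.1 q.2)
      (fderiv ℝ B p.1 w.1 p.2 + B p.1 w.2) p w := by
  have := (hB.hasFDerivAt.comp_prod_fst.clm_apply (hasFDerivAt_snd (p := p))).hasLineDerivAt w
  simpa [add_comm] using this

theorem DifferentiableAt.hasLineDerivAt_bilin_fst_apply_snd {A : V → V →L[ℝ] V →L[ℝ] ℝ}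
    (hA : DifferentiableAt ℝ A p.1) (w : V × V) (v : V) :
    HasLineDerivAt ℝ (fun q : V × V => A q.1 v q.2)
      (fderiv ℝ A p.1 w.1 v p.2 + A p.1 v w.2) p w := by
  have h1 := HasFDerivAt.comp_prod_fst (X := V →L[ℝ] V →L[ℝ] ℝ) (p := p) hA.hasFDerivAt
  have := ((h1.clm_apply (hasFDerivAt_const v p)).clm_apply
    (hasFDerivAt_snd (p := p))).hasLineDerivAt w
  simpa [add_comm] using this

theorem DifferentiableAt.hasLineDerivAt_bilin_fst_apply_snd_snd {A : V → V →L[ℝ] V →L[ℝ] ℝ}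
    (hA : DifferentiableAt ℝ A p.1) (w : V × V) :
    HasLineDerivAt ℝ (fun q : V × V => A q.1 q.2 q.2)
      (fderiv ℝ A p.1 w.1 p.2 p.2 + A p.1 w.2 p.2 + A p.1 p.2 w.2) p w := by
  have h1 := HasFDerivAt.comp_prod_fst (X := V →L[ℝ] V →L[ℝ] ℝ) (p := p) hA.hasFDerivAt
  have := ((h1.clm_apply (hasFDerivAt_snd (p := p))).clm_apply
    (hasFDerivAt_snd (p := p))).hasLineDerivAt w
  simpa [add_assoc, add_comm, add_left_comm] using this

theorem DifferentiableAt.hasLineDerivAt_bilin_apply {A : V → V →L[ℝ] V →L[ℝ] ℝ} {x : V}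
    (hA : DifferentiableAt ℝ A x) (u v w : V) :
    HasLineDerivAt ℝ (fun q => A q v w) (fderiv ℝ A x u v w) x u := by
  have := ((hA.hasFDerivAt.clm_apply (hasFDerivAt_const v x)).clm_apply
    (hasFDerivAt_const w x)).hasLineDerivAt u
  simpa using this

theorem DifferentiableAt.hasLineDerivAt_dual_apply {x : V}
    (hB : DifferentiableAt ℝ B x) (u v : V) :
    HasLineDerivAt ℝ (fun q => B q v) (fderiv ℝ B x u v) x u := by
  have := (hB.hasFDerivAt.clm_apply (hasFDerivAt_const v x)).hasLineDerivAt u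
  simpa using this

end ProductLineDeriv

/-! ### A two-homogeneous function with `A(y,y) d log e = 2 A(·,y)` -/

section Fibre

variable {V : Type*} [NormedAddCommGroup V] [NormedSpace ℝ V]

theorem fderiv_apply_self_of_homogeneous {e : V → ℝ} {y : V} (he : DifferentiableAt ℝ e y)
    (hhom : ∀ t : ℝ, 0 < t → e (t • y) = t ^ 2 * e y) : fderiv ℝ e y y = 2 * e y := by
  have h1 : HasLineDerivAt ℝ e (fderiv ℝ e y y) y y := he.hasFDerivAt.hasLineDerivAt y
  have h2 : HasDerivAt (fun t : ℝ => (1 + t) ^ 2 * e y) (2 * e y) 0 := by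
    have := (((hasDerivAt_id (0 : ℝ)).const_add 1).pow 2).mul_const (e y)
    simpa using this
  refine HasDerivAt.unique h1 (h2.congr_of_eventuallyEq ?_)
  filter_upwards [lt_mem_nhds (show (-1 : ℝ) < 0 by norm_num)] with t ht
  rw [← hhom (1 + t) (by linarith), add_smul, one_smul]

variable {A : V →L[ℝ] V →L[ℝ] ℝ} {e : V → ℝ}

theorem hasLineDerivAt_bilin_diag (A : V →L[ℝ] V →L[ℝ] ℝ) (y z : V) :
    HasLineDerivAt ℝ (fun q => A q q) (A z y + A y z) y z := by
  have := ((A.hasFDerivAt (x := y)).clm_apply (hasFDerivAt_id y)).hasLineDerivAt z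
  simpa [add_comm] using this

theorem hasLineDerivAt_bilin_left (A : V →L[ℝ] V →L[ℝ] ℝ) (v y z : V) :
    HasLineDerivAt ℝ (fun q => A v q) (A v z) y z :=
  (A v).hasFDerivAt.hasLineDerivAt z

/-- Differentiating `A(y,y) de = 2 A(·,y) e` once more. -/
theorem fderiv_identity_deriv (he : ContDiffOn ℝ 2 e {0}ᶜ)
    (h : ∀ y ≠ 0, ∀ v, A y y * fderiv ℝ e y v = 2 * (A v y * e y)) {y : V} (hy : y ≠ 0) (v z : V) :
    (A z y + A y z) * fderiv ℝ e y v + A y y * fderiv ℝ (fderiv ℝ e) y z v =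
      2 * (A v z * e y + A v y * fderiv ℝ e y z) := by
  have hy' : y ∈ ({0}ᶜ : Set V) := hy
  have hey : ContDiffAt ℝ 2 e y := he.contDiffAt (isOpen_compl_singleton.mem_nhds hy')
  exact HasLineDerivAt.eq_of_eqOn isOpen_compl_singleton hy' (fun q hq => h q hq v)
    ((hasLineDerivAt_bilin_diag A y z).mul_real (hey.hasLineDerivAt_fderiv_apply z v))
    (((hasLineDerivAt_bilin_left A v y z).mul_real
      ((hey.differentiableAt (by norm_num)).hasFDerivAt.hasLineDerivAt z)).const_mul_real 2)

/-- A nonzero isotropic vector of `A` forces `A = 0`: the derivative of the identity at that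
vector writes `A` as a rank one form `u ⊗ r` on which the identity can be tested again. -/
theorem bilin_eq_zero_of_isotropic (he : ContDiffOn ℝ 2 e {0}ᶜ) (hpos : ∀ y ≠ 0, 0 < e y)
    (heuler : ∀ y ≠ 0, fderiv ℝ e y y = 2 * e y)
    (h : ∀ y ≠ 0, ∀ v, A y y * fderiv ℝ e y v = 2 * (A v y * e y)) {y₀ : V} (hy₀ : y₀ ≠ 0)
    (h0 : A y₀ y₀ = 0) : A = 0 := by
  have hker : ∀ y ≠ 0, A y y = 0 → ∀ v, A v y = 0 := by
    intro y hy hyy v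
    have := h y hy v
    rw [hyy, zero_mul] at this
    exact (mul_eq_zero.1 (by linarith : A v y * e y = 0)).resolve_right (hpos y hy).ne'
  have hrank : ∀ v z, A y₀ z * fderiv ℝ e y₀ v = 2 * (A v z * e y₀) := by
    intro v z
    have := fderiv_identity_deriv he h hy₀ v z
    rw [h0, hker y₀ hy₀ h0, hker y₀ hy₀ h0] at this
    linarith
  have he0 := hpos y₀ hy₀
  have hr : ∀ z, fderiv ℝ e y₀ z = 0 → A y₀ z = 0 := by
    intro z hz
    rcases eq_or_ne z 0 with rfl | hz0
    · simp
    · apply hker z hz0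
      have := hrank z z
      rw [hz, mul_zero] at this
      exact (mul_eq_zero.1 (by linarith : A z z * e y₀ = 0)).resolve_right he0.ne'
  have hr' : ∀ z, A y₀ z = 0 := by
    intro z
    have h1 := hr (z - (fderiv ℝ e y₀ z / (2 * e y₀)) • y₀) (by
      rw [map_sub, map_smul, heuler y₀ hy₀, smul_eq_mul]
      field_simp
      ring)
    rw [map_sub, map_smul, h0, smul_zero, sub_zero] at h1
    exact h1
  ext v z
  have := hrank v z
  rw [hr', zero_mul] at this
  exact (mul_eq_zero.1 (by linarith : A v z * e y₀ = 0)).resolve_right he0.ne'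

/-- If `A` has no isotropic vectors, `e / A(y,y)` has a critical point, where the
antisymmetric part of `A` degenerates; the derivative of the identity then kills that part. -/
theorem bilin_symm_of_anisotropic [FiniteDimensional ℝ V] (he : ContDiffOn ℝ 2 e {0}ᶜ)
    (hpos : ∀ y ≠ 0, 0 < e y)
    (hhom : ∀ y ≠ 0, ∀ t : ℝ, 0 < t → e (t • y) = t ^ 2 * e y)
    (h : ∀ y ≠ 0, ∀ v, A y y * fderiv ℝ e y v = 2 * (A v y * e y))
    (hA : ∀ y ≠ 0, A y y ≠ 0) (u v : V) : A u v = A v u := by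
  rcases subsingleton_or_nontrivial V with hV | hV
  · rw [Subsingleton.elim u v]
  have hAc : Continuous fun y => A y y := by fun_prop
  have hcont : ContinuousOn (fun y => e y / A y y) (Metric.sphere 0 1) := by
    refine ContinuousOn.div (he.continuousOn.mono ?_) hAc.continuousOn ?_
    · intro y hy h0
      rw [mem_singleton_iff] at h0
      simp [h0] at hy
    · intro y hy
      exact hA y (by rintro rfl; simp at hy)
  have := FiniteDimensional.proper ℝ V
  obtain ⟨y₀, hy₀s, hmax⟩ := (isCompact_sphere (0 : V) 1).exists_isMaxOn
    (NormedSpace.sphere_nonempty.2 zero_le_one) hcont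
  have hy₀ : y₀ ≠ 0 := by rintro rfl; simp at hy₀s
  have hey : ContDiffAt ℝ 2 e y₀ := he.contDiffAt (isOpen_compl_singleton.mem_nhds hy₀)
  -- by homogeneity the maximum on the sphere is a maximum among all nonzero vectors
  have hloc : IsLocalMax (fun y => e y / A y y) y₀ := by
    filter_upwards [isOpen_compl_singleton.mem_nhds (show y₀ ∈ ({0}ᶜ : Set V) from hy₀)]
      with y hy
    have hn : 0 < ‖y‖ := norm_pos_iff.2 hy
    have h1 : e (‖y‖⁻¹ • y) / A (‖y‖⁻¹ • y) (‖y‖⁻¹ • y) ≤ e y₀ / A y₀ y₀ :=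
      hmax (by simp [norm_smul, hn.ne'])
    rw [hhom y hy _ (inv_pos.2 hn)] at h1
    simp only [map_smul, smul_apply, smul_eq_mul] at h1
    rw [← mul_assoc, ← pow_two, mul_div_mul_left _ _ (by positivity)] at h1
    exact h1
  have hA0 := hA y₀ hy₀
  have hcrit : ∀ z, A z y₀ = A y₀ z := by
    intro z
    have h1 := (hey.differentiableAt (by norm_num)).hasFDerivAt.hasLineDerivAt z
    have h2 := hasLineDerivAt_bilin_diag A y₀ z
    have h3 : HasDerivAt (fun t : ℝ => e (y₀ + t • z) / A (y₀ + t • z) (y₀ + t • z)) _ 0 :=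
      HasDerivAt.div h1 h2 (by simpa using hA0)
    have hloc' : IsLocalMax (fun t : ℝ => e (y₀ + t • z) / A (y₀ + t • z) (y₀ + t • z)) 0 := by
      have hc : Tendsto (fun t : ℝ => y₀ + t • z) (𝓝 0) (𝓝 y₀) := by
        have : Continuous fun t : ℝ => y₀ + t • z := by fun_prop
        simpa using this.tendsto 0
      have := hc.eventually hloc
      simpa [IsLocalMax, IsMaxFilter] using this
    have h4 := hloc'.hasDerivAt_eq_zero h3
    simp only [zero_smul, add_zero] at h4
    rw [div_eq_zero_iff] at h4
    rcases h4 with h4 | h4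
    · have h5 := h y₀ hy₀ z
      have h6 : e y₀ * (A z y₀ - A y₀ z) = 0 := by linarith
      have := (hpos y₀ hy₀).ne'
      rcases mul_eq_zero.1 h6 with h7 | h7
      · exact absurd h7 this
      · linarith
    · exact absurd h4 (pow_ne_zero 2 hA0)
  have e1 := fderiv_identity_deriv he h hy₀ v u
  have e2 := fderiv_identity_deriv he h hy₀ u v
  rw [hey.fderiv_fderiv_comm v u] at e2
  rw [← hcrit] at e1 e2
  have e3 := h y₀ hy₀ u
  have e4 := h y₀ hy₀ v
  have key : (A y₀ y₀ * e y₀) * (A u v - A v u) = 0 := by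
    linear_combination (A y₀ y₀ / 2) * (e1 - e2) - 2 * A u y₀ * e4 + 2 * A v y₀ * e3
  rcases mul_eq_zero.1 key with h7 | h7
  · exact absurd h7 (mul_ne_zero hA0 (hpos y₀ hy₀).ne')
  · linarith

end Fibre

/-! ### The Euler-Lagrange equation of a one-form deformation of the flat spray -/

section EulerLagrange

variable {V : Type*} [NormedAddCommGroup V] [NormedSpace ℝ V]
  {U : Set V} {E : V × V → ℝ} {B : V → V →L[ℝ] ℝ}

theorem isOpen_prod_compl_zero {V : Type*} [NormedAddCommGroup V] {U : Set V} (hU : IsOpen U) : IsOpen (U ×ˢ ({0}ᶜ : Set V)) :=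
  hU.prod isOpen_compl_singleton

theorem ContDiffOn.contDiffAt_two {W X : Type*} [NormedAddCommGroup W] [NormedSpace ℝ W]
    [NormedAddCommGroup X] [NormedSpace ℝ X] {f : W → X} {s : Set W} {q : W}
    (hf : ContDiffOn ℝ ∞ f s) (hs : IsOpen s) (hq : q ∈ s) : ContDiffAt ℝ 2 f q :=
  contDiffAt_infty.1 (hf.contDiffAt (hs.mem_nhds hq)) 2

theorem fderiv_apply_split (f : V × V → ℝ) (p : V × V) (u v : V) :
    fderiv ℝ f p (u, v) = fderiv ℝ f p (u, 0) + fderiv ℝ f p (0, v) := by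
  rw [← map_add]; simp

theorem fderiv_fderiv_apply_split (f : V × V → ℝ) (p w : V × V) (u v : V) :
    fderiv ℝ (fderiv ℝ f) p (u, v) w =
      fderiv ℝ (fderiv ℝ f) p (u, 0) w + fderiv ℝ (fderiv ℝ f) p (0, v) w := by
  rw [← add_apply, ← map_add]; simp

theorem fderiv_fderiv_apply_smul_snd (f : V × V → ℝ) (p w : V × V) (c : ℝ) (v : V) :
    fderiv ℝ (fderiv ℝ f) p (0, c • v) w = c * fderiv ℝ (fderiv ℝ f) p (0, v) w := by
  have : ((0 : V), c • v) = c • ((0 : V), v) := by simp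
  rw [this, map_smul]; rfl

/-- The derivative of Euler's identity `dE(0, y) = 2 E`. -/
theorem fderiv_euler_deriv (hU : IsOpen U) (hE : ContDiffOn ℝ ∞ E (U ×ˢ {0}ᶜ))
    (heuler : ∀ p ∈ U ×ˢ ({0}ᶜ : Set V), fderiv ℝ E p (0, p.2) = 2 * E p) {p : V × V}
    (hp : p ∈ U ×ˢ ({0}ᶜ : Set V)) (w : V × V) :
    fderiv ℝ (fderiv ℝ E) p w (0, p.2) + fderiv ℝ E p (0, w.2) = 2 * fderiv ℝ E p w := by
  have hΩ := isOpen_prod_compl_zero hU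
  have hEp := hE.contDiffAt_two hΩ hp
  exact HasLineDerivAt.eq_of_eqOn hΩ hp heuler (hEp.hasLineDerivAt_fderiv_fibre w)
    ((hEp.hasLineDerivAt_self w).const_mul_real 2)

/-- The first-order system equivalent to the Euler-Lagrange equation. For a two-homogeneous `E` it
says that `E` is constant along the horizontal vector fields `v ∂/∂x - (β v + B(v) y) ∂/∂y` of the
deformed spray. -/
def IsHorizontallyConstant (U : Set V) (B : V → V →L[ℝ] ℝ) (E : V × V → ℝ) : Prop :=
  ∀ p ∈ U ×ˢ ({0}ᶜ : Set V), ∀ v,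
    fderiv ℝ E p (v, 0) = B p.1 p.2 * fderiv ℝ E p (0, v) + 2 * (B p.1 v * E p)

/-- The derivative of the horizontal system in a direction `w` of the tangent bundle. -/
theorem IsHorizontallyConstant.deriv (hU : IsOpen U) (hE : ContDiffOn ℝ ∞ E (U ×ˢ {0}ᶜ))
    (hB : ContDiffOn ℝ ∞ B U) (hH : IsHorizontallyConstant U B E) {p : V × V}
    (hp : p ∈ U ×ˢ ({0}ᶜ : Set V)) (w : V × V) (v : V) :
    fderiv ℝ (fderiv ℝ E) p w (v, 0) =
      (fderiv ℝ B p.1 w.1 p.2 + B p.1 w.2) * fderiv ℝ E p (0, v)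
        + B p.1 p.2 * fderiv ℝ (fderiv ℝ E) p w (0, v)
        + 2 * (fderiv ℝ B p.1 w.1 v * E p + B p.1 v * fderiv ℝ E p w) := by
  have hΩ := isOpen_prod_compl_zero hU
  have hEp := hE.contDiffAt_two hΩ hp
  have hBp := (hB.contDiffAt_two hU hp.1).differentiableAt (by norm_num)
  exact HasLineDerivAt.eq_of_eqOn hΩ hp (fun q hq => hH q hq v)
    (hEp.hasLineDerivAt_fderiv_apply w (v, 0))
    (((hBp.hasLineDerivAt_fst_apply_snd w).mul_real
      (hEp.hasLineDerivAt_fderiv_apply w (0, v))).add_real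
      (((hBp.hasLineDerivAt_fst_apply w v).mul_real
        (hEp.hasLineDerivAt_self w)).const_mul_real 2))

/-- The Euler-Lagrange equation implies that `E` is constant along the spray; differentiating this
in the fibre and comparing with the equation itself gives the horizontal system. -/
theorem isHorizontallyConstant_of_eulerLagrange (hU : IsOpen U)
    (hE : ContDiffOn ℝ ∞ E (U ×ˢ {0}ᶜ)) (hB : ContDiffOn ℝ ∞ B U)
    (heuler : ∀ p ∈ U ×ˢ ({0}ᶜ : Set V), fderiv ℝ E p (0, p.2) = 2 * E p)
    (hEL : ∀ p ∈ U ×ˢ ({0}ᶜ : Set V), ∀ v,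
      fderiv ℝ (fderiv ℝ E) p (p.2, -(2 * B p.1 p.2) • p.2) (0, v) = fderiv ℝ E p (v, 0)) :
    IsHorizontallyConstant U B E := by
  have hΩ := isOpen_prod_compl_zero hU
  have hA : ∀ p ∈ U ×ˢ ({0}ᶜ : Set V), ∀ v,
      fderiv ℝ (fderiv ℝ E) p (0, v) (p.2, 0) - 2 * B p.1 p.2 * fderiv ℝ E p (0, v)
        = fderiv ℝ E p (v, 0) := by
    intro p hp v
    have hEp := hE.contDiffAt_two hΩ hp
    have h1 := hEL p hp v
    rw [fderiv_fderiv_apply_split, fderiv_fderiv_apply_smul_snd, hEp.fderiv_fderiv_comm (p.2, 0),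
      hEp.fderiv_fderiv_comm (0, p.2)] at h1
    have h2 := fderiv_euler_deriv hU hE heuler hp (0, v)
    simp only at h2
    linear_combination h1 + 2 * B p.1 p.2 * h2
  -- contracting with the direction of the fibre gives the derivative of `E` along the spray
  have hS : ∀ p ∈ U ×ˢ ({0}ᶜ : Set V), fderiv ℝ E p (p.2, 0) = 4 * (B p.1 p.2 * E p) := by
    intro p hp
    have hEp := hE.contDiffAt_two hΩ hp
    have h1 := hA p hp p.2
    rw [hEp.fderiv_fderiv_comm (0, p.2)] at h1
    have h2 := fderiv_euler_deriv hU hE heuler hp (p.2, 0)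
    simp only [Prod.mk_zero_zero, map_zero] at h2
    have h3 := heuler p hp
    linear_combination h1 - h2 + 2 * B p.1 p.2 * h3
  intro p hp v
  have hEp := hE.contDiffAt_two hΩ hp
  have hBp := (hB.contDiffAt_two hU hp.1).differentiableAt (by norm_num)
  have h1 := HasLineDerivAt.eq_of_eqOn hΩ hp hS (hEp.hasLineDerivAt_fderiv_base (0, v))
    (((hBp.hasLineDerivAt_fst_apply_snd (0, v)).mul_real
        (hEp.hasLineDerivAt_self (0, v))).const_mul_real 4)
  simp only [map_zero, zero_apply, zero_add] at h1
  linear_combination (1 / 2) * h1 - (1 / 2) * hA p hp v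

theorem IsHorizontallyConstant.eulerLagrange (hU : IsOpen U)
    (hE : ContDiffOn ℝ ∞ E (U ×ˢ {0}ᶜ)) (hB : ContDiffOn ℝ ∞ B U)
    (heuler : ∀ p ∈ U ×ˢ ({0}ᶜ : Set V), fderiv ℝ E p (0, p.2) = 2 * E p)
    (hH : IsHorizontallyConstant U B E) {p : V × V} (hp : p ∈ U ×ˢ ({0}ᶜ : Set V)) (v : V) :
    fderiv ℝ (fderiv ℝ E) p (p.2, -(2 * B p.1 p.2) • p.2) (0, v) = fderiv ℝ E p (v, 0) := by
  have hEp := hE.contDiffAt_two (isOpen_prod_compl_zero hU) hp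
  have h1 := hH.deriv hU hE hB hp (0, v) p.2
  have h2 := fderiv_euler_deriv hU hE heuler hp (0, v)
  simp only [map_zero, zero_apply, zero_add, zero_mul] at h1 h2
  rw [fderiv_fderiv_apply_split, fderiv_fderiv_apply_smul_snd, hEp.fderiv_fderiv_comm (p.2, 0),
    hEp.fderiv_fderiv_comm (0, p.2)]
  have h3 := hH p hp v
  have h4 := heuler p hp
  linear_combination h1 - B p.1 p.2 * h2 - h3 + B p.1 v * h4

/-- The bilinear form `A(v, y) = B(v) B(y) + (∂_y B)(v) - 2 (∂_v B)(y)`. The Jacobi endomorphism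
of the deformed spray is `A(y, y) J - A(·, y) ⊗ C`. -/
noncomputable def curvForm (B : V → V →L[ℝ] ℝ) (x : V) : V →L[ℝ] V →L[ℝ] ℝ :=
  (B x).smulRight (B x) + (fderiv ℝ B x).flip - (2 : ℝ) • fderiv ℝ B x

theorem curvForm_apply (x v y : V) : curvForm B x v y =
    B x v * B x y + fderiv ℝ B x y v - 2 * fderiv ℝ B x v y := by
  simp [curvForm]

/-- The integrability condition of the horizontal system: the second derivatives
`∂_v ∂_y E` and `∂_y ∂_v E` in the base directions `v` and `y` agree. -/
theorem IsHorizontallyConstant.curvForm_identity (hU : IsOpen U)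
    (hE : ContDiffOn ℝ ∞ E (U ×ˢ {0}ᶜ)) (hB : ContDiffOn ℝ ∞ B U)
    (heuler : ∀ p ∈ U ×ˢ ({0}ᶜ : Set V), fderiv ℝ E p (0, p.2) = 2 * E p)
    (hH : IsHorizontallyConstant U B E) {p : V × V} (hp : p ∈ U ×ˢ ({0}ᶜ : Set V)) (v : V) :
    curvForm B p.1 p.2 p.2 * fderiv ℝ E p (0, v) = 2 * (curvForm B p.1 v p.2 * E p) := by
  have hEp := hE.contDiffAt_two (isOpen_prod_compl_zero hU) hp
  have h1 := hH.deriv hU hE hB hp (p.2, 0) v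
  have h2 := hH.deriv hU hE hB hp (v, 0) p.2
  have h3 := hH.deriv hU hE hB hp (0, v) p.2
  have h4 := hH.deriv hU hE hB hp (0, p.2) v
  have h5 := hH p hp v
  have h6 := hH p hp p.2
  have h7 := heuler p hp
  rw [hEp.fderiv_fderiv_comm (v, 0) (p.2, 0)] at h2
  rw [hEp.fderiv_fderiv_comm (p.2, 0) (0, v)] at h1
  rw [hEp.fderiv_fderiv_comm (v, 0) (0, p.2)] at h2
  rw [hEp.fderiv_fderiv_comm (0, p.2) (0, v)] at h4
  simp only [map_zero, zero_apply, zero_add, zero_mul, add_zero] at h1 h2 h3 h4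
  rw [curvForm_apply, curvForm_apply]
  rw [h3] at h1
  rw [h4] at h2
  rw [h1] at h2
  rw [h5, h6, h7] at h2
  linear_combination -h2
end EulerLagrange

/-! ### Closedness of the one-form and parallelism of the curvature -/

section Parallel

variable {V : Type*} [NormedAddCommGroup V] [NormedSpace ℝ V]
  {U : Set V} {E : V × V → ℝ} {B : V → V →L[ℝ] ℝ}

theorem fderiv_fibre_apply {x y : V} (hE : DifferentiableAt ℝ E (x, y)) (v : V) :
    fderiv ℝ (fun z => E (x, z)) y v = fderiv ℝ E (x, y) (0, v) := by
  have := (hE.hasFDerivAt.comp y (hasFDerivAt_prodMk_right x y)).fderiv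
  have h2 : fderiv ℝ (fun z => E (x, z)) y =
    (fderiv ℝ E (x, y)).comp (ContinuousLinearMap.inr ℝ V V) := this
  rw [h2]; simp

theorem fderiv_euler_of_homogeneous (hU : IsOpen U) (hE : ContDiffOn ℝ ∞ E (U ×ˢ {0}ᶜ))
    (hhom : ∀ p ∈ U ×ˢ ({0}ᶜ : Set V), ∀ t : ℝ, 0 < t → E (p.1, t • p.2) = t ^ 2 * E p)
    {p : V × V} (hp : p ∈ U ×ˢ ({0}ᶜ : Set V)) : fderiv ℝ E p (0, p.2) = 2 * E p := by
  have hd := (hE.contDiffAt_two (isOpen_prod_compl_zero hU) hp).differentiableAt (by norm_num)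
  rw [← fderiv_fibre_apply (x := p.1) hd]
  exact fderiv_apply_self_of_homogeneous (e := fun z => E (p.1, z))
    (hd.comp p.2 (hasFDerivAt_prodMk_right p.1 p.2).differentiableAt) (hhom p hp)

/-- At each point the curvature form is symmetric, and is zero or anisotropic. -/
theorem IsHorizontallyConstant.curvForm_dichotomy [FiniteDimensional ℝ V] (hU : IsOpen U)
    (hE : ContDiffOn ℝ ∞ E (U ×ˢ {0}ᶜ)) (hB : ContDiffOn ℝ ∞ B U)
    (hpos : ∀ p ∈ U ×ˢ ({0}ᶜ : Set V), 0 < E p)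
    (hhom : ∀ p ∈ U ×ˢ ({0}ᶜ : Set V), ∀ t : ℝ, 0 < t → E (p.1, t • p.2) = t ^ 2 * E p)
    (hH : IsHorizontallyConstant U B E) {x : V} (hx : x ∈ U) :
    (curvForm B x = 0 ∨ ∀ y ≠ 0, curvForm B x y y ≠ 0) ∧
      ∀ u v, curvForm B x u v = curvForm B x v u := by
  have hΩ := isOpen_prod_compl_zero hU
  have heuler := fun p hp => fderiv_euler_of_homogeneous hU hE hhom (p := p) hp
  have hmem : ∀ y : V, y ≠ 0 → (x, y) ∈ U ×ˢ ({0}ᶜ : Set V) := fun y hy => ⟨hx, hy⟩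
  have hd : ∀ y : V, y ≠ 0 → DifferentiableAt ℝ E (x, y) := fun y hy =>
    (hE.contDiffAt_two hΩ (hmem y hy)).differentiableAt (by norm_num)
  have he : ContDiffOn ℝ 2 (fun z => E (x, z)) {0}ᶜ := fun y hy =>
    ((hE.contDiffAt_two hΩ (hmem y hy)).comp y
      (contDiffAt_const.prodMk contDiffAt_id)).contDiffWithinAt
  have hid : ∀ y ≠ 0, ∀ v, curvForm B x y y * fderiv ℝ (fun z => E (x, z)) y v =
      2 * (curvForm B x v y * E (x, y)) := by
    intro y hy v
    rw [fderiv_fibre_apply (hd y hy)]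
    exact hH.curvForm_identity hU hE hB heuler (hmem y hy) v
  have heu : ∀ y ≠ 0, fderiv ℝ (fun z => E (x, z)) y y = 2 * E (x, y) := by
    intro y hy
    rw [fderiv_fibre_apply (hd y hy)]
    exact heuler _ (hmem y hy)
  have hp : ∀ y ≠ 0, 0 < E (x, y) := fun y hy => hpos _ (hmem y hy)
  by_cases hiso : ∃ y ≠ 0, curvForm B x y y = 0
  · obtain ⟨y, hy, h0⟩ := hiso
    have hA := bilin_eq_zero_of_isotropic he hp heu hid hy h0
    refine ⟨Or.inl hA, fun u v => by rw [hA]; rfl⟩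
  · push Not at hiso
    exact ⟨Or.inr hiso, bilin_symm_of_anisotropic he hp
      (fun y hy t ht => hhom _ (hmem y hy) t ht) hid hiso⟩

theorem fderiv_symm_of_curvForm_symm {x : V} {u v : V}
    (h : curvForm B x u v = curvForm B x v u) : fderiv ℝ B x u v = fderiv ℝ B x v u := by
  rw [curvForm_apply, curvForm_apply] at h
  linarith

/-- The bilinear form `a = B ⊗ B - ∂B`. For a closed one-form `B = -dh / (2 h)` it equals
`∂²h / (2 h) - dh ⊗ dh / (4 h²)`, and it is the curvature form of the deformed spray. -/
noncomputable def deformForm (B : V → V →L[ℝ] ℝ) (x : V) : V →L[ℝ] V →L[ℝ] ℝ :=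
  (B x).smulRight (B x) - fderiv ℝ B x

theorem deformForm_apply (x v w : V) :
    deformForm B x v w = B x v * B x w - fderiv ℝ B x v w := by
  simp [deformForm]

theorem curvForm_eq_deformForm {x : V} (h : ∀ u v, fderiv ℝ B x u v = fderiv ℝ B x v u) :
    curvForm B x = deformForm B x := by
  ext v w
  rw [curvForm_apply, deformForm_apply, h w v]
  ring

theorem deformForm_symm {x : V} (h : ∀ u v, fderiv ℝ B x u v = fderiv ℝ B x v u) (u v : V) :
    deformForm B x u v = deformForm B x v u := by
  rw [deformForm_apply, deformForm_apply, h u v]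
  ring

theorem contDiffOn_deformForm (hU : IsOpen U) (hB : ContDiffOn ℝ ∞ B U) :
    ContDiffOn ℝ ∞ (deformForm B) U := by
  have h1 : ContDiffOn ℝ ∞ (fderiv ℝ B) U := hB.fderiv_of_isOpen hU (by simp)
  have h2 : ContDiffOn ℝ ∞ (fun x => (B x).smulRight (B x)) U := hB.smulRight hB
  exact h2.sub h1

theorem differentiableAt_deformForm (hU : IsOpen U) (hB : ContDiffOn ℝ ∞ B U) {x : V}
    (hx : x ∈ U) : DifferentiableAt ℝ (deformForm B) x :=
  ((contDiffOn_deformForm hU hB).contDiffAt_two hU hx).differentiableAt (by norm_num)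

theorem fderiv_deformForm_apply (hU : IsOpen U) (hB : ContDiffOn ℝ ∞ B U) {x : V} (hx : x ∈ U)
    (u v w : V) : fderiv ℝ (deformForm B) x u v w =
      fderiv ℝ B x u v * B x w + B x v * fderiv ℝ B x u w
        - fderiv ℝ (fderiv ℝ B) x u v w := by
  have hB2 := hB.contDiffAt_two hU hx
  have hB1 := hB2.differentiableAt (by norm_num)
  exact HasLineDerivAt.eq_of_eqOn hU hx (fun q _ => deformForm_apply q v w)
    ((differentiableAt_deformForm hU hB hx).hasLineDerivAt_bilin_apply u v w)
    (((hB1.hasLineDerivAt_dual_apply u v).mul_real (hB1.hasLineDerivAt_dual_apply u w)).sub_real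
      (hB2.hasFDerivAt_fderiv.differentiableAt.hasLineDerivAt_bilin_apply u v w))

/-- With `q(v, w) = ∂_u a(v, w) - B(v) a(u, w) - B(w) a(u, v)`, the base derivative of the identity
`a(y, y) ∂E/∂yᵛ = 2 a(v, y) E` reduces to `q(y, y) a(v, y) = a(y, y) q(v, y)`. -/
theorem IsHorizontallyConstant.covariant_deriv_identity (hU : IsOpen U)
    (hE : ContDiffOn ℝ ∞ E (U ×ˢ {0}ᶜ)) (hB : ContDiffOn ℝ ∞ B U)
    (hpos : ∀ p ∈ U ×ˢ ({0}ᶜ : Set V), 0 < E p)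
    (heuler : ∀ p ∈ U ×ˢ ({0}ᶜ : Set V), fderiv ℝ E p (0, p.2) = 2 * E p)
    (hH : IsHorizontallyConstant U B E)
    (hcl : ∀ x ∈ U, ∀ u v, fderiv ℝ B x u v = fderiv ℝ B x v u) {x y : V} (hx : x ∈ U)
    (hy : y ≠ 0) (u v : V) :
    (fderiv ℝ (deformForm B) x u y y - 2 * (B x y * deformForm B x u y)) * deformForm B x v y =
      deformForm B x y y * (fderiv ℝ (deformForm B) x u v y - B x v * deformForm B x u y
        - B x y * deformForm B x u v) := by
  have hΩ := isOpen_prod_compl_zero hU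
  have hid : ∀ p ∈ U ×ˢ ({0}ᶜ : Set V), ∀ v,
      deformForm B p.1 p.2 p.2 * fderiv ℝ E p (0, v) = 2 * (deformForm B p.1 v p.2 * E p) := by
    intro p hp v
    rw [← curvForm_eq_deformForm (hcl p.1 hp.1)]
    exact hH.curvForm_identity hU hE hB heuler hp v
  have hp : ((x, y) : V × V) ∈ U ×ˢ ({0}ᶜ : Set V) := ⟨hx, hy⟩
  have hEp := hE.contDiffAt_two hΩ hp
  have ha : DifferentiableAt ℝ (deformForm B) ((x, y) : V × V).1 :=
    differentiableAt_deformForm hU hB hx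
  have hder : ∀ w : V × V, _ := fun w => HasLineDerivAt.eq_of_eqOn hΩ hp
    (fun q hq => hid q hq v)
    ((ha.hasLineDerivAt_bilin_fst_apply_snd_snd w).mul_real
      (hEp.hasLineDerivAt_fderiv_apply w (0, v)))
    (((ha.hasLineDerivAt_bilin_fst_apply_snd w v).mul_real
      (hEp.hasLineDerivAt_self w)).const_mul_real 2)
  have h1 := hder (u, 0)
  have h2 := hder (0, u)
  have h3 := hid _ hp u
  have h4 := hid _ hp v
  have h5 := hH.deriv hU hE hB hp (0, v) u
  have h6 := hH _ hp u
  rw [hEp.fderiv_fderiv_comm (u, 0) (0, v), h5, h6] at h1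
  simp only [map_zero, zero_apply, zero_add, zero_mul, add_zero] at h1 h2 h3 h4
  rw [hEp.fderiv_fderiv_comm (0, u) (0, v)] at h2
  have hs := deformForm_symm (hcl x hx) u y
  have hs2 := deformForm_symm (hcl x hx) u v
  have hEpos := (hpos _ hp).ne'
  rw [← hs] at h2
  rw [← hs2] at h2
  -- `a(y, y)` times the base derivative, with every fibre derivative of `E` eliminated
  have key : (2 * E (x, y)) * ((fderiv ℝ (deformForm B) x u y y
      - 2 * (B x y * deformForm B x u y)) * deformForm B x v y -
      deformForm B x y y * (fderiv ℝ (deformForm B) x u v y - B x v * deformForm B x u y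
        - B x y * deformForm B x u v)) = 0 := by
    linear_combination (deformForm B x y y) * h1 - B x y * deformForm B x y y * h2
      - (fderiv ℝ (deformForm B) x u y y) * h4
      - B x v * deformForm B x y y * h3
      + (2 * B x y * deformForm B x u y - 2 * B x u * deformForm B x y y) * h4
  rcases mul_eq_zero.1 key with h | h
  · exact absurd h (by simpa using hEpos)
  · linarith
end Parallel

section Proportional

variable {V : Type*} [NormedAddCommGroup V] [NormedSpace ℝ V]

/-- Two symmetric forms with `q(y, y) a(v, y) = a(y, y) q(v, y)` are proportional when `a` has no
isotropic vectors. -/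
theorem exists_eq_mul_of_polar_identity (a : V →L[ℝ] V →L[ℝ] ℝ) (q : V → V → ℝ)
    (ha : ∀ y ≠ 0, a y y ≠ 0) (has : ∀ v w, a v w = a w v) (hqs : ∀ v w, q v w = q w v)
    (h : ∀ y ≠ 0, ∀ v, q y y * a v y = a y y * q v y) (hq0 : ∀ v, q v 0 = 0) :
    ∃ m : ℝ, ∀ v w, q v w = m * a v w := by
  by_cases hV : ∃ y₀ : V, y₀ ≠ 0
  swap
  · push Not at hV
    exact ⟨0, fun v w => by rw [hV w, hq0, map_zero, mul_zero]⟩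
  obtain ⟨y₀, hy₀⟩ := hV
  have hm : ∀ y ≠ 0, ∀ v, q v y = q y y / a y y * a v y := by
    intro y hy v
    have := ha y hy
    field_simp
    linarith [h y hy v]
  have hconst : ∀ v ≠ 0, ∀ y ≠ 0, a v y ≠ 0 → q v v / a v v = q y y / a y y := by
    intro v hv y hy hvy
    have h1 := hm y hy v
    rw [hqs, hm v hv y, has y v] at h1
    exact mul_right_cancel₀ hvy h1
  refine ⟨q y₀ y₀ / a y₀ y₀, fun v w => ?_⟩
  rcases eq_or_ne w 0 with rfl | hw
  · rw [hq0, map_zero, mul_zero]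
  rw [hm w hw v]
  congr 1
  by_cases h0 : a w y₀ = 0
  · have h1 : a w (w + y₀) ≠ 0 := by rw [map_add, h0, add_zero]; exact ha w hw
    have h2 : a y₀ (w + y₀) ≠ 0 := by
      rw [map_add, has y₀ w, h0, zero_add]; exact ha y₀ hy₀
    have h3 : w + y₀ ≠ 0 := by
      intro h3; rw [h3, map_zero] at h1; exact h1 rfl
    rw [hconst w hw _ h3 h1, hconst y₀ hy₀ _ h3 h2]
  · exact hconst w hw y₀ hy₀ h0

end Proportional

section ParallelCurvature

variable {V : Type*} [NormedAddCommGroup V] [NormedSpace ℝ V]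
  {U : Set V} {E : V × V → ℝ} {B : V → V →L[ℝ] ℝ}

theorem fderiv_deformForm_symm (hU : IsOpen U) (hB : ContDiffOn ℝ ∞ B U)
    (hcl : ∀ x ∈ U, ∀ u v, fderiv ℝ B x u v = fderiv ℝ B x v u) {x : V} (hx : x ∈ U)
    (u v w : V) :
    fderiv ℝ (deformForm B) x u v w = fderiv ℝ (deformForm B) x u w v := by
  have ha := differentiableAt_deformForm hU hB hx
  exact HasLineDerivAt.eq_of_eqOn hU hx (fun q hq => deformForm_symm (hcl q hq) v w)
    (ha.hasLineDerivAt_bilin_apply u v w) (ha.hasLineDerivAt_bilin_apply u w v)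

/-- The Bianchi-type identity that follows from the symmetry of the second derivatives of `B`. -/
theorem fderiv_deformForm_antisymm (hU : IsOpen U) (hB : ContDiffOn ℝ ∞ B U)
    (hcl : ∀ x ∈ U, ∀ u v, fderiv ℝ B x u v = fderiv ℝ B x v u) {x : V} (hx : x ∈ U)
    (u v w : V) :
    fderiv ℝ (deformForm B) x u v w - fderiv ℝ (deformForm B) x v u w =
      B x u * deformForm B x v w - B x v * deformForm B x u w := by
  rw [fderiv_deformForm_apply hU hB hx, fderiv_deformForm_apply hU hB hx,
    (hB.contDiffAt_two hU hx).fderiv_fderiv_comm u v, deformForm_apply, deformForm_apply,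
    hcl x hx u v]
  ring

/-- The third-order equation `∂_u a(v, w) = B(v) a(u, w) + B(w) a(u, v) + 2 B(u) a(v, w)` for
`a = B ⊗ B - ∂B`. For `B = -dh / (2 h)` it says that the third derivatives of `h` vanish. -/
def IsDeformParallelAt (B : V → V →L[ℝ] ℝ) (x : V) : Prop :=
  ∀ u v w, fderiv ℝ (deformForm B) x u v w =
    B x v * deformForm B x u w + B x w * deformForm B x u v + 2 * (B x u * deformForm B x v w)

/-- Where `a` is anisotropic, `∂_u a(v, w) - B(v) a(u, w) - B(w) a(u, v)` is a multiple `m(u) a` of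
`a`, and antisymmetry in `u`, `v` gives `m = 2 B`. -/
theorem IsHorizontallyConstant.isDeformParallelAt_of_anisotropic [FiniteDimensional ℝ V]
    (hV : 1 < Module.finrank ℝ V) (hU : IsOpen U)
    (hE : ContDiffOn ℝ ∞ E (U ×ˢ {0}ᶜ)) (hB : ContDiffOn ℝ ∞ B U)
    (hpos : ∀ p ∈ U ×ˢ ({0}ᶜ : Set V), 0 < E p)
    (heuler : ∀ p ∈ U ×ˢ ({0}ᶜ : Set V), fderiv ℝ E p (0, p.2) = 2 * E p)
    (hH : IsHorizontallyConstant U B E)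
    (hcl : ∀ x ∈ U, ∀ u v, fderiv ℝ B x u v = fderiv ℝ B x v u) {x : V} (hx : x ∈ U)
    (ha : ∀ y ≠ 0, deformForm B x y y ≠ 0) : IsDeformParallelAt B x := by
  have has := deformForm_symm (hcl x hx)
  have hprop : ∀ u, ∃ m : ℝ, ∀ v w, fderiv ℝ (deformForm B) x u v w
      - B x v * deformForm B x u w - B x w * deformForm B x u v = m * deformForm B x v w := by
    intro u
    apply exists_eq_mul_of_polar_identity (deformForm B x) _ ha has
    · intro v w
      rw [fderiv_deformForm_symm hU hB hcl hx u v w]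
      ring
    · intro y hy v
      have := hH.covariant_deriv_identity hU hE hB hpos heuler hcl hx hy u v
      linear_combination this
    · intro v
      simp
  choose m hm using hprop
  have he : ∀ u v w, (m u - 2 * B x u) * deformForm B x v w =
      (m v - 2 * B x v) * deformForm B x u w := by
    intro u v w
    have h1 := hm u v w
    have h2 := hm v u w
    have h3 := fderiv_deformForm_antisymm hU hB hcl hx u v w
    rw [has v u] at h2
    linear_combination h3 - h1 + h2
  have hm2 : ∀ u v w, (m u - 2 * B x u) * deformForm B x v w = 0 := by
    intro u v w
    -- in dimension at least two there is a nonzero vector orthogonal to `u`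
    have hker : LinearMap.ker (deformForm B x u : V →ₗ[ℝ] ℝ) ≠ ⊥ :=
      LinearMap.ker_ne_bot_of_finrank_lt (by simpa using hV)
    obtain ⟨y, hy, hy0⟩ := Submodule.exists_mem_ne_zero_of_ne_bot hker
    have hy' : deformForm B x u y = 0 := hy
    have h1 := he u y y
    rw [hy', mul_zero] at h1
    rw [(mul_eq_zero.1 h1).resolve_right (ha y hy0), zero_mul]
  intro u v w
  linear_combination hm u v w + hm2 u v w

theorem continuousAt_of_contDiffOn_infty {X : Type*} [NormedAddCommGroup X] [NormedSpace ℝ X]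
    {f : V → X} (hU : IsOpen U) (hf : ContDiffOn ℝ ∞ f U) {x : V} (hx : x ∈ U) :
    ContinuousAt f x :=
  (hf.contDiffAt_two hU hx).continuousAt

/-- The energy forces the form to be closed and its curvature to be parallel. Points where the
curvature form vanishes are reached by continuity, or have a neighbourhood where it vanishes. -/
theorem IsHorizontallyConstant.closed_and_parallel [FiniteDimensional ℝ V]
    (hV : 1 < Module.finrank ℝ V) (hU : IsOpen U)
    (hE : ContDiffOn ℝ ∞ E (U ×ˢ {0}ᶜ)) (hB : ContDiffOn ℝ ∞ B U)
    (hpos : ∀ p ∈ U ×ˢ ({0}ᶜ : Set V), 0 < E p)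
    (hhom : ∀ p ∈ U ×ˢ ({0}ᶜ : Set V), ∀ t : ℝ, 0 < t → E (p.1, t • p.2) = t ^ 2 * E p)
    (hH : IsHorizontallyConstant U B E) :
    (∀ x ∈ U, ∀ u v, fderiv ℝ B x u v = fderiv ℝ B x v u) ∧
      ∀ x ∈ U, IsDeformParallelAt B x := by
  have hcl : ∀ x ∈ U, ∀ u v, fderiv ℝ B x u v = fderiv ℝ B x v u := fun x hx u v =>
    fderiv_symm_of_curvForm_symm ((hH.curvForm_dichotomy hU hE hB hpos hhom hx).2 u v)
  have heuler := fun p hp => fderiv_euler_of_homogeneous hU hE hhom (p := p) hp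
  refine ⟨hcl, fun x hx => ?_⟩
  have hdef : ∀ q ∈ U, deformForm B q ≠ 0 → IsDeformParallelAt B q := by
    intro q hq h0
    rcases (hH.curvForm_dichotomy hU hE hB hpos hhom hq).1 with h1 | h1
    · rw [curvForm_eq_deformForm (hcl q hq)] at h1
      exact absurd h1 h0
    · rw [curvForm_eq_deformForm (hcl q hq)] at h1
      exact hH.isDeformParallelAt_of_anisotropic hV hU hE hB hpos heuler hcl hq h1
  by_cases hev : ∀ᶠ q in 𝓝 x, deformForm B q = 0
  · have h1 : fderiv ℝ (deformForm B) x = 0 := by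
      rw [Filter.EventuallyEq.fderiv_eq (f := fun _ => 0) hev]
      simp
    intro u v w
    rw [h1, hev.self_of_nhds]
    simp
  · have hfr : ∃ᶠ q in 𝓝 x, IsDeformParallelAt B q := by
      have h1 : ∃ᶠ q in 𝓝 x, deformForm B q ≠ 0 := not_eventually.1 hev
      exact (h1.and_eventually (hU.mem_nhds hx)).mono fun q hq => hdef q hq.2 hq.1
    intro u v w
    have hB0 := continuousAt_of_contDiffOn_infty hU hB hx
    have ha := contDiffOn_deformForm hU hB
    have ha0 := continuousAt_of_contDiffOn_infty hU ha hx
    have ha1 := continuousAt_of_contDiffOn_infty hU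
      (ha.fderiv_of_isOpen hU (m := ∞) (by simp)) hx
    have hc1 : ContinuousAt (fun q => fderiv ℝ (deformForm B) q u v w) x :=
      ((ha1.clm_apply continuousAt_const).clm_apply continuousAt_const).clm_apply
        continuousAt_const
    have hca : ∀ s t, ContinuousAt (fun q => deformForm B q s t) x := fun s t =>
      (ha0.clm_apply continuousAt_const).clm_apply continuousAt_const
    have hcB : ∀ s, ContinuousAt (fun q => B q s) x := fun s =>
      hB0.clm_apply continuousAt_const
    have hc2 : ContinuousAt (fun q => fderiv ℝ (deformForm B) q u v w -
        (B q v * deformForm B q u w + B q w * deformForm B q u v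
          + 2 * (B q u * deformForm B q v w))) x :=
      hc1.sub ((((hcB v).mul (hca u w)).add ((hcB w).mul (hca u v))).add
        (continuousAt_const.mul ((hcB u).mul (hca v w))))
    by_contra hne
    have h2 := hc2.eventually_ne (sub_ne_zero.2 hne)
    obtain ⟨q, hq1, hq2⟩ := (hfr.and_eventually h2).exists
    exact hq2 (sub_eq_zero.2 (hq1 u v w))

end ParallelCurvature

/-! ### The osculating quadratic functions -/

section Osculating

variable {V : Type*} [NormedAddCommGroup V] [NormedSpace ℝ V]
  {U : Set V} {B : V → V →L[ℝ] ℝ}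

/-- A solution of a linear homogeneous first-order equation that vanishes at one point of a
connected open set vanishes identically. -/
theorem eq_zero_of_fderiv_eq_mul {f : V → ℝ} {c : V → V →L[ℝ] ℝ} (hU : IsOpen U)
    (hUc : IsPreconnected U) (hc : ContinuousOn c U)
    (hf : ∀ x ∈ U, HasFDerivAt f (f x • c x) x) {x₀ : V} (hx₀ : x₀ ∈ U) (h0 : f x₀ = 0) :
    ∀ x ∈ U, f x = 0 := by
  have hfc : ContinuousOn f U := fun x hx => (hf x hx).continuousAt.continuousWithinAt
  have hopen : IsOpen {x | x ∈ U ∧ f x = 0} := by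
    rw [isOpen_iff_mem_nhds]
    rintro x ⟨hx, hfx⟩
    have hcx : ContinuousAt c x := hc.continuousAt (hU.mem_nhds hx)
    have hbd : ∀ᶠ y in 𝓝 x, ‖c y‖ < ‖c x‖ + 1 :=
      hcx.norm.eventually_lt continuousAt_const (lt_add_one _)
    obtain ⟨r, hr, hball⟩ := Metric.mem_nhds_iff.1 (hbd.and (hU.mem_nhds hx))
    filter_upwards [Metric.ball_mem_nhds x hr] with y hy
    refine ⟨(hball hy).2, ?_⟩
    have hseg : ∀ t ∈ Icc (0 : ℝ) 1, x + t • (y - x) ∈ Metric.ball x r := by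
      intro t ht
      exact (convex_ball x r).add_smul_sub_mem (Metric.mem_ball_self hr) hy ht
    have hder : ∀ t ∈ Icc (0 : ℝ) 1, HasDerivAt (fun t : ℝ => f (x + t • (y - x)))
        (f (x + t • (y - x)) * c (x + t • (y - x)) (y - x)) t := by
      intro t ht
      have h1 : HasDerivAt (fun t : ℝ => x + t • (y - x)) (y - x) t := by
        simpa using ((hasDerivAt_id t).smul_const (y - x)).const_add x
      exact (hf _ (hball (hseg t ht)).2).comp_hasDerivAt t h1
    have := eq_zero_of_abs_deriv_le_mul_abs_self_of_eq_zero_right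
      (f := fun t : ℝ => f (x + t • (y - x))) (a := 0) (b := 1)
      (K := (‖c x‖ + 1) * ‖y - x‖)
      (fun t ht => (hder t ht).continuousAt.continuousWithinAt)
      (fun t ht => (hder t (Ico_subset_Icc_self ht)).hasDerivWithinAt)
      (by simpa using hfx)
      (fun t ht => by
        rw [norm_mul, mul_comm]
        gcongr
        exact ((c _).le_opNorm _).trans
          (by gcongr; exact (hball (hseg t (Ico_subset_Icc_self ht))).1.le))
      1 (by simp)
    simpa using this
  have hsub := hUc.subset_of_closure_inter_subset hopen ⟨x₀, hx₀, hx₀, h0⟩ (by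
    rintro x ⟨hxc, hx⟩
    refine ⟨hx, ?_⟩
    by_contra hne
    have h1 := ((hfc.continuousAt (hU.mem_nhds hx)).eventually_ne hne)
    obtain ⟨q, hq1, hq2⟩ := (mem_closure_iff_frequently.1 hxc |>.and_eventually h1).exists
    exact hq2 hq1.2)
  exact fun x hx => (hsub hx).2

/-- The quadratic function that osculates at `x` the local solution `h` of `dh = -2 h B` with
`h(x) = 1`. -/
noncomputable def osculatingQuad (B : V → V →L[ℝ] ℝ) (x z : V) : ℝ :=
  1 - 2 * B x (z - x) + B x (z - x) * B x (z - x) + deformForm B x (z - x) (z - x)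

theorem osculatingQuad_self (x : V) : osculatingQuad B x x = 1 := by
  simp [osculatingQuad]

theorem hasFDerivAt_osculatingQuad (hU : IsOpen U) (hB : ContDiffOn ℝ ∞ B U)
    (hcl : ∀ x ∈ U, ∀ u v, fderiv ℝ B x u v = fderiv ℝ B x v u)
    (hpar : ∀ x ∈ U, IsDeformParallelAt B x) {x : V} (hx : x ∈ U) (z : V) :
    HasFDerivAt (fun q => osculatingQuad B q z) (osculatingQuad B x z • ((2 : ℝ) • B x)) x := by
  have hd : HasFDerivAt (fun q => z - q) (-ContinuousLinearMap.id ℝ V) x :=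
    (hasFDerivAt_id x).const_sub z
  have hBx := ((hB.contDiffAt_two hU hx).differentiableAt (by norm_num)).hasFDerivAt.clm_apply hd
  have hax := ((differentiableAt_deformForm hU hB hx).hasFDerivAt.clm_apply hd).clm_apply hd
  have h := (((hBx.const_mul 2).const_sub 1).add (hBx.mul hBx)).add hax
  refine h.congr_fderiv ?_
  ext u
  have h1 := hpar x hx u (z - x) (z - x)
  have h2 := deformForm_apply (B := B) x u (z - x)
  have h3 := deformForm_symm (hcl x hx) (z - x) u
  simp only [osculatingQuad, add_apply, neg_apply, smul_apply, smul_eq_mul,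
    ContinuousLinearMap.comp_apply, ContinuousLinearMap.flip_apply, map_neg,
    ContinuousLinearMap.id_apply]
  rw [h1, h3]
  linear_combination (2 * B x (z - x) - 2) * h2
end Osculating

section OsculatingGlobal

variable {V : Type*} [NormedAddCommGroup V] [NormedSpace ℝ V]
  {U : Set V} {B : V → V →L[ℝ] ℝ}

/-- The osculating quadratic functions at different points of `U` are proportional, since each of
their values solves the same linear equation `∂f = 2 f B` in the point of osculation. -/
theorem osculatingQuad_eq_mul (hU : IsOpen U) (hUc : IsPreconnected U)
    (hB : ContDiffOn ℝ ∞ B U) (hcl : ∀ x ∈ U, ∀ u v, fderiv ℝ B x u v = fderiv ℝ B x v u)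
    (hpar : ∀ x ∈ U, IsDeformParallelAt B x) {x₀ x : V} (hx₀ : x₀ ∈ U) (hx : x ∈ U) (z : V) :
    osculatingQuad B x z = osculatingQuad B x x₀ * osculatingQuad B x₀ z := by
  have h := eq_zero_of_fderiv_eq_mul
    (f := fun q => osculatingQuad B q z - osculatingQuad B q x₀ * osculatingQuad B x₀ z)
    (c := fun q => (2 : ℝ) • B q) hU hUc (by exact hB.continuousOn.const_smul (2 : ℝ)) (fun q hq => by
      have h1 := (hasFDerivAt_osculatingQuad hU hB hcl hpar hq z).sub
        ((hasFDerivAt_osculatingQuad hU hB hcl hpar hq x₀).mul_const (osculatingQuad B x₀ z))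
      refine h1.congr_fderiv ?_
      ext u
      simp
      ring) hx₀ (by simp [osculatingQuad_self]) x hx
  exact sub_eq_zero.1 h

/-- The form is determined on all of `U` by the osculating quadratic function at one point. -/
theorem osculatingQuad_global (hU : IsOpen U) (hUc : IsPreconnected U)
    (hB : ContDiffOn ℝ ∞ B U) (hcl : ∀ x ∈ U, ∀ u v, fderiv ℝ B x u v = fderiv ℝ B x v u)
    (hpar : ∀ x ∈ U, IsDeformParallelAt B x) {x₀ x : V} (hx₀ : x₀ ∈ U) (hx : x ∈ U) :
    osculatingQuad B x₀ x ≠ 0 ∧ ∀ v, B x v * osculatingQuad B x₀ x =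
      B x₀ v - B x₀ (x - x₀) * B x₀ v - deformForm B x₀ (x - x₀) v := by
  have hmul := osculatingQuad_eq_mul hU hUc hB hcl hpar hx₀ hx
  have h1 := hmul x
  rw [osculatingQuad_self] at h1
  have h0 : osculatingQuad B x₀ x ≠ 0 := right_ne_zero_of_mul (h1 ▸ one_ne_zero)
  refine ⟨h0, fun v => ?_⟩
  -- the linear term at `x` of a quadratic function is half the difference of its values at `x ± v`
  have h2 := hmul (x + v)
  have h3 := hmul (x - v)
  have e1 : x + v - x = v := by abel
  have e2 : x - v - x = -v := by abel
  have e3 : x + v - x₀ = (x - x₀) + v := by abel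
  have e4 : x - v - x₀ = (x - x₀) - v := by abel
  have h5 := deformForm_symm (hcl x₀ hx₀) v (x - x₀)
  have h6 : osculatingQuad B x (x + v) - osculatingQuad B x (x - v) = -4 * B x v := by
    simp only [osculatingQuad, e1, e2, map_neg, neg_apply]
    ring
  have h7 : osculatingQuad B x₀ (x + v) - osculatingQuad B x₀ (x - v) =
      -4 * B x₀ v + 4 * (B x₀ (x - x₀) * B x₀ v) + 4 * deformForm B x₀ (x - x₀) v := by
    simp only [osculatingQuad, e3, e4]
    generalize x - x₀ = d at h5 ⊢
    simp only [map_add, map_sub, add_apply, sub_apply, h5]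
    ring
  linear_combination (1 / 4 * osculatingQuad B x₀ x) * (h6 - h2 + h3)
    - 1 / 4 * osculatingQuad B x x₀ * osculatingQuad B x₀ x * h7
    - (B x₀ v - B x₀ (x - x₀) * B x₀ v - deformForm B x₀ (x - x₀) v) * h1

/-- The form `-dh / (2 h)` of a quadratic function `h` is closed with parallel curvature: both
facts come from differentiating `2 h B = -dh` and `h (a + B ⊗ B) = ∂²h / 2`. -/
theorem closed_and_parallel_of_quadratic (hU : IsOpen U) (hB : ContDiffOn ℝ ∞ B U)
    (Q : V →L[ℝ] V →L[ℝ] ℝ) (ℓ : V →L[ℝ] ℝ) (c : ℝ) (hQ : ∀ u v, Q u v = Q v u)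
    (h0 : ∀ x ∈ U, Q x x + ℓ x + c ≠ 0)
    (hBQ : ∀ x ∈ U, ∀ v, B x v * (2 * (Q x x + ℓ x + c)) = -(2 * Q x v + ℓ v)) :
    (∀ x ∈ U, ∀ u v, fderiv ℝ B x u v = fderiv ℝ B x v u) ∧
      ∀ x ∈ U, IsDeformParallelAt B x := by
  have hh : ∀ x u, HasLineDerivAt ℝ (fun q => Q q q + ℓ q + c) (2 * Q x u + ℓ u) x u := by
    intro x u
    have h1 := ((hasLineDerivAt_bilin_diag Q x u).add_real
      (ℓ.hasFDerivAt.hasLineDerivAt u)).add_real ((hasFDerivAt_const c x).hasLineDerivAt u)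
    convert h1 using 1
    rw [hQ u x]
    simp
    ring
  have hlin : ∀ x u v, HasLineDerivAt ℝ (fun q => Q q v) (Q u v) x u := by
    intro x u v
    have := ((Q.hasFDerivAt (x := x)).clm_apply (hasFDerivAt_const v x)).hasLineDerivAt u
    simpa using this
  have hB1 : ∀ x ∈ U, DifferentiableAt ℝ B x := fun x hx =>
    (hB.contDiffAt_two hU hx).differentiableAt (by norm_num)
  have hε : ∀ x ∈ U, ∀ u v, (Q x x + ℓ x + c) * (2 * (B x u * B x v) - fderiv ℝ B x u v)
      = Q u v := by
    intro x hx u v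
    have h1 := HasLineDerivAt.eq_of_eqOn hU hx (fun q hq => hBQ q hq v)
      (((hB1 x hx).hasLineDerivAt_dual_apply u v).mul_real ((hh x u).const_mul_real 2))
      (g' := -1 * (2 * Q u v + 0)) (by
        have := (((hlin x u v).const_mul_real 2).add_real
          ((hasFDerivAt_const (ℓ v) x).hasLineDerivAt u)).const_mul_real (-1)
        simpa [neg_mul] using this)
    have h2 := hBQ x hx u
    linear_combination (-1 / 2) * h1 + B x v * h2
  have hcl : ∀ x ∈ U, ∀ u v, fderiv ℝ B x u v = fderiv ℝ B x v u := by
    intro x hx u v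
    have h1 := hε x hx u v
    rw [hQ u v, ← hε x hx v u] at h1
    have h2 := mul_left_cancel₀ (h0 x hx) h1
    linarith
  refine ⟨hcl, fun x hx u v w => ?_⟩
  have ha : ∀ q ∈ U, (Q q q + ℓ q + c) * (deformForm B q v w + B q v * B q w) = Q v w := by
    intro q hq
    rw [← hε q hq v w, deformForm_apply]
    ring
  have h1 := HasLineDerivAt.eq_of_eqOn hU hx ha
    ((hh x u).mul_real (((differentiableAt_deformForm hU hB hx).hasLineDerivAt_bilin_apply
      u v w).add_real (((hB1 x hx).hasLineDerivAt_dual_apply u v).mul_real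
        ((hB1 x hx).hasLineDerivAt_dual_apply u w))))
    ((hasFDerivAt_const (Q v w) x).hasLineDerivAt u)
  simp only [zero_apply] at h1
  have h2 := hBQ x hx u
  apply mul_left_cancel₀ (h0 x hx)
  rw [deformForm_apply x u w, deformForm_apply x u v]
  linear_combination h1 - (deformForm B x v w + B x v * B x w) * h2

end OsculatingGlobal

/-! ### The curvature form as an energy -/

section CurvatureEnergy

variable {V : Type*} [NormedAddCommGroup V] [NormedSpace ℝ V]
  {U : Set V} {B : V → V →L[ℝ] ℝ}

/-- The quadratic form `a(y, y)` as a function on the tangent bundle. -/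
noncomputable def deformQuad (B : V → V →L[ℝ] ℝ) (p : V × V) : ℝ := deformForm B p.1 p.2 p.2

theorem contDiffOn_deformQuad (hU : IsOpen U) (hB : ContDiffOn ℝ ∞ B U) :
    ContDiffOn ℝ ∞ (deformQuad B) (U ×ˢ {0}ᶜ) := by
  have h1 : ContDiffOn ℝ ∞ (fun p : V × V => deformForm B p.1) (U ×ˢ {0}ᶜ) :=
    (contDiffOn_deformForm hU hB).comp contDiff_fst.contDiffOn (fun p hp => hp.1)
  exact (h1.clm_apply contDiff_snd.contDiffOn).clm_apply contDiff_snd.contDiffOn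

theorem fderiv_deformQuad_apply (hU : IsOpen U) (hB : ContDiffOn ℝ ∞ B U) {p : V × V}
    (hp : p ∈ U ×ˢ ({0}ᶜ : Set V)) (w : V × V) :
    fderiv ℝ (deformQuad B) p w = fderiv ℝ (deformForm B) p.1 w.1 p.2 p.2
      + deformForm B p.1 w.2 p.2 + deformForm B p.1 p.2 w.2 :=
  ((contDiffOn_deformQuad hU hB).contDiffAt_two
    (isOpen_prod_compl_zero hU) hp).hasLineDerivAt_self w |>.unique
    ((differentiableAt_deformForm hU hB hp.1).hasLineDerivAt_bilin_fst_apply_snd_snd w)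

theorem deformQuad_smul (x y : V) (t : ℝ) :
    deformQuad B (x, t • y) = t ^ 2 * deformQuad B (x, y) := by
  simp [deformQuad]
  ring

/-- The parallel curvature form satisfies the horizontal system, so it is an energy. -/
theorem isHorizontallyConstant_deformQuad (hU : IsOpen U) (hB : ContDiffOn ℝ ∞ B U)
    (hcl : ∀ x ∈ U, ∀ u v, fderiv ℝ B x u v = fderiv ℝ B x v u)
    (hpar : ∀ x ∈ U, IsDeformParallelAt B x) :
    IsHorizontallyConstant U B (deformQuad B) := by
  intro p hp v
  rw [fderiv_deformQuad_apply hU hB hp, fderiv_deformQuad_apply hU hB hp,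
    hpar p.1 hp.1, deformForm_symm (hcl p.1 hp.1) p.2 v]
  simp [deformQuad]
  ring

theorem IsHorizontallyConstant.const_mul {E E' : V × V → ℝ} (hU : IsOpen U) (c : ℝ)
    (hE : ContDiffOn ℝ ∞ E (U ×ˢ {0}ᶜ)) (hH : IsHorizontallyConstant U B E)
    (hEE' : ∀ p ∈ U ×ˢ ({0}ᶜ : Set V), E' p = c * E p) : IsHorizontallyConstant U B E' := by
  intro p hp v
  have h1 : fderiv ℝ E' p = c • fderiv ℝ E p := by
    have h2 : E' =ᶠ[𝓝 p] fun q => c * E q := by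
      filter_upwards [(isOpen_prod_compl_zero hU).mem_nhds hp] with q hq using hEE' q hq
    rw [h2.fderiv_eq]
    exact fderiv_const_mul
      ((hE.contDiffAt_two (isOpen_prod_compl_zero hU) hp).differentiableAt (by norm_num)) c
  rw [h1, hEE' p hp]
  have := hH p hp v
  simp only [smul_apply, smul_eq_mul]
  rw [this]
  ring

/-- A nowhere vanishing curvature form is definite, with the same sign at all points. -/
theorem exists_sign_deformQuad [FiniteDimensional ℝ V] (hV : 1 < Module.finrank ℝ V)
    (hU : IsOpen U) (hUc : IsConnected U) (hB : ContDiffOn ℝ ∞ B U)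
    (hne : ∀ p ∈ U ×ˢ ({0}ᶜ : Set V), deformQuad B p ≠ 0) :
    ∃ s : ℝ, (s = 1 ∨ s = -1) ∧ ∀ p ∈ U ×ˢ ({0}ᶜ : Set V), 0 < s * deformQuad B p := by
  have hconn : IsPreconnected (U ×ˢ ({0}ᶜ : Set V)) :=
    hUc.isPreconnected.prod (isConnected_compl_singleton_of_one_lt_rank
      (Module.one_lt_rank_of_one_lt_finrank hV) 0).isPreconnected
  have hcont : ContinuousOn (deformQuad B) (U ×ˢ {0}ᶜ) := (contDiffOn_deformQuad hU hB).continuousOn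
  by_cases hpos : ∀ p ∈ U ×ˢ ({0}ᶜ : Set V), 0 < deformQuad B p
  · exact ⟨1, Or.inl rfl, fun p hp => by rw [one_mul]; exact hpos p hp⟩
  · push Not at hpos
    obtain ⟨q, hq, hq0⟩ := hpos
    refine ⟨-1, Or.inr rfl, fun p hp => ?_⟩
    by_contra hp0
    have hp1 : 0 ≤ deformQuad B p := by linarith
    obtain ⟨r, hr, hr0⟩ := hconn.intermediate_value hq hp hcont ⟨hq0, hp1⟩
    exact hne r hr hr0

end CurvatureEnergy

/-! ### Coordinates -/

section Coordinates

variable {n : ℕ} {U : Set (Vec n)} {b : Vec n → Vec n}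

/-- The one-form `∑ bₖ dxᵏ` as a map into the dual space. -/
noncomputable def dualForm (b : Vec n → Vec n) (x : Vec n) : Vec n →L[ℝ] ℝ :=
  ∑ k, b x k • ContinuousLinearMap.proj (R := ℝ) (φ := fun _ : Fin n => ℝ) k

theorem dualForm_apply (x y : Vec n) : dualForm b x y = ∑ k, b x k * y k := by
  simp [dualForm]

theorem dualForm_single (x : Vec n) (k : Fin n) : dualForm b x (Pi.single k 1) = b x k := by
  simp [dualForm_apply, Pi.single_apply]

theorem contDiffOn_dualForm (hb : ContDiffOn ℝ ∞ b U) : ContDiffOn ℝ ∞ (dualForm b) U := by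
  unfold dualForm
  exact ContDiffOn.sum fun k _ => (contDiffOn_pi.1 hb k).smul contDiffOn_const

theorem apply_eq_sum_single (f : Vec n →L[ℝ] ℝ) (x : Vec n) :
    f x = ∑ i, x i * f (Pi.single i 1) := by
  conv_lhs => rw [pi_eq_sum_univ' x]
  simp only [map_sum, map_smul, smul_eq_mul]

theorem bilin_eq_sum_single (M : Vec n →L[ℝ] Vec n →L[ℝ] ℝ) (x y : Vec n) :
    M x y = ∑ i, ∑ j, M (Pi.single i 1) (Pi.single j 1) * x i * y j := by
  have h1 := apply_eq_sum_single (M.flip y) x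
  simp only [ContinuousLinearMap.flip_apply] at h1
  rw [h1]
  refine Finset.sum_congr rfl fun i _ => ?_
  rw [apply_eq_sum_single (M (Pi.single i 1)) y, Finset.mul_sum]
  exact Finset.sum_congr rfl fun j _ => by ring

theorem oneFormDeformation_eq (b : Vec n → Vec n) (p : TBundle n) :
    oneFormDeformation b p = (p.2, -(2 * dualForm b p.1 p.2) • p.2) := by
  have h : oneFormFun b p = dualForm b p.1 p.2 := by
    rw [dualForm_apply, oneFormFun]
    exact Finset.sum_congr rfl fun k _ => mul_comm _ _
  simp [oneFormDeformation, flatSpray, liouville, h]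

theorem fderiv_apply_of_hasLineDerivAt {W : Type*} [NormedAddCommGroup W] [NormedSpace ℝ W]
    {f : W → ℝ} {p w : W} {f' : ℝ} (hf : DifferentiableAt ℝ f p)
    (h : HasLineDerivAt ℝ f f' p w) : fderiv ℝ f p w = f' :=
  (hf.hasFDerivAt.hasLineDerivAt w).unique h

theorem hasLineDerivAt_coord (i : Fin n) (p w : TBundle n) :
    HasLineDerivAt ℝ (fun q : TBundle n => q.2 i) (w.2 i) p w :=
  ((ContinuousLinearMap.proj (R := ℝ) (φ := fun _ : Fin n => ℝ) i).comp
    (ContinuousLinearMap.snd ℝ (Vec n) (Vec n))).hasFDerivAt.hasLineDerivAt w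

/-! ### The Jacobi endomorphism -/

theorem sprayCoeff_oneFormDeformation (i : Fin n) :
    sprayCoeff (oneFormDeformation b) i = fun q => dualForm b q.1 q.2 * q.2 i := by
  funext q
  rw [sprayCoeff, oneFormDeformation_eq]
  simp
  ring

theorem differentiableAt_dualForm_fst (hU : IsOpen U) (hb : ContDiffOn ℝ ∞ b U) {p : TBundle n}
    (hp : p.1 ∈ U) : DifferentiableAt ℝ (fun q : TBundle n => dualForm b q.1) p :=
  (((contDiffOn_dualForm hb).contDiffAt_two hU hp).differentiableAt
    (by norm_num)).hasFDerivAt.comp_prod_fst.differentiableAt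

theorem fderiv_sprayCoeff (hU : IsOpen U) (hb : ContDiffOn ℝ ∞ b U) {p : TBundle n}
    (hp : p.1 ∈ U) (i : Fin n) (w : TBundle n) :
    fderiv ℝ (sprayCoeff (oneFormDeformation b) i) p w =
      (fderiv ℝ (dualForm b) p.1 w.1 p.2 + dualForm b p.1 w.2) * p.2 i
        + dualForm b p.1 p.2 * w.2 i := by
  rw [sprayCoeff_oneFormDeformation]
  have hd := differentiableAt_dualForm_fst hU hb hp
  have hB := ((contDiffOn_dualForm hb).contDiffAt_two hU hp).differentiableAt (by norm_num)
  apply fderiv_apply_of_hasLineDerivAt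
  · fun_prop
  · exact (hB.hasLineDerivAt_fst_apply_snd w).mul_real (hasLineDerivAt_coord i p w)

theorem connCoeff_oneFormDeformation (hU : IsOpen U) (hb : ContDiffOn ℝ ∞ b U) {p : TBundle n}
    (hp : p.1 ∈ U) (i j : Fin n) :
    connCoeff (oneFormDeformation b) i j p =
      dualForm b p.1 (Pi.single j 1) * p.2 i
        + dualForm b p.1 p.2 * (1 : Matrix (Fin n) (Fin n) ℝ) i j := by
  rw [connCoeff, pdy, fderiv_sprayCoeff hU hb hp]
  simp [Matrix.one_apply, Pi.single_apply]

theorem fderiv_connCoeff (hU : IsOpen U) (hb : ContDiffOn ℝ ∞ b U) {p : TBundle n}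
    (hp : p.1 ∈ U) (i j : Fin n) (w : TBundle n) :
    fderiv ℝ (connCoeff (oneFormDeformation b) i j) p w =
      fderiv ℝ (dualForm b) p.1 w.1 (Pi.single j 1) * p.2 i
        + dualForm b p.1 (Pi.single j 1) * w.2 i
        + (fderiv ℝ (dualForm b) p.1 w.1 p.2 + dualForm b p.1 w.2)
          * (1 : Matrix (Fin n) (Fin n) ℝ) i j := by
  have h1 : connCoeff (oneFormDeformation b) i j =ᶠ[𝓝 p] fun q =>
      dualForm b q.1 (Pi.single j 1) * q.2 i
        + dualForm b q.1 q.2 * (1 : Matrix (Fin n) (Fin n) ℝ) i j := by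
    filter_upwards [(hU.preimage continuous_fst).mem_nhds hp] with q hq
    exact connCoeff_oneFormDeformation hU hb hq i j
  rw [h1.fderiv_eq]
  have hd := differentiableAt_dualForm_fst hU hb hp
  have hB := ((contDiffOn_dualForm hb).contDiffAt_two hU hp).differentiableAt (by norm_num)
  apply fderiv_apply_of_hasLineDerivAt
  · fun_prop
  · have h2 := ((hB.hasLineDerivAt_fst_apply w (Pi.single j 1)).mul_real
      (hasLineDerivAt_coord i p w)).add_real
      ((hB.hasLineDerivAt_fst_apply_snd w).mul_real
      ((hasFDerivAt_const ((1 : Matrix (Fin n) (Fin n) ℝ) i j) p).hasLineDerivAt w))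
    simpa using h2

theorem jacobiEndo_oneFormDeformation (hU : IsOpen U) (hb : ContDiffOn ℝ ∞ b U) {p : TBundle n}
    (hp : p.1 ∈ U) (i j : Fin n) :
    jacobiEndo (oneFormDeformation b) p i j =
      curvForm (dualForm b) p.1 p.2 p.2 * (1 : Matrix (Fin n) (Fin n) ℝ) i j
        - curvForm (dualForm b) p.1 (Pi.single j 1) p.2 * p.2 i := by
  have hsum : ∑ k, connCoeff (oneFormDeformation b) i k p * connCoeff (oneFormDeformation b) k j p
      = dualForm b p.1 p.2 ^ 2 * (1 : Matrix (Fin n) (Fin n) ℝ) i j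
        + 3 * (dualForm b p.1 p.2 * dualForm b p.1 (Pi.single j 1) * p.2 i) := by
    have h1 := apply_eq_sum_single (dualForm b p.1) p.2
    have h2 : ∀ k, connCoeff (oneFormDeformation b) i k p * connCoeff (oneFormDeformation b) k j p
        = (dualForm b p.1 (Pi.single j 1) * p.2 i) * (p.2 k * dualForm b p.1 (Pi.single k 1))
          + (dualForm b p.1 p.2 * p.2 i)
            * (dualForm b p.1 (Pi.single k 1) * (1 : Matrix (Fin n) (Fin n) ℝ) k j)
          + (dualForm b p.1 p.2 * dualForm b p.1 (Pi.single j 1))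
            * ((1 : Matrix (Fin n) (Fin n) ℝ) i k * p.2 k)
          + dualForm b p.1 p.2 ^ 2 * ((1 : Matrix (Fin n) (Fin n) ℝ) i k
            * (1 : Matrix (Fin n) (Fin n) ℝ) k j) := by
      intro k
      rw [connCoeff_oneFormDeformation hU hb hp, connCoeff_oneFormDeformation hU hb hp]
      ring
    simp only [h2, Finset.sum_add_distrib, ← Finset.mul_sum, ← h1, ← Matrix.mul_apply, mul_one]
    simp only [Matrix.one_apply, mul_ite, mul_one, mul_zero, ite_mul, one_mul, zero_mul,
      Finset.sum_ite_eq, Finset.sum_ite_eq', Finset.mem_univ, if_true]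
    ring
  rw [jacobiEndo, Matrix.of_apply, hsum, pdx, fderiv_sprayCoeff hU hb hp,
    fderiv_connCoeff hU hb hp, oneFormDeformation_eq, curvForm_apply, curvForm_apply]
  simp only [map_zero, map_smul, smul_eq_mul, Pi.smul_apply, Pi.zero_apply]
  ring

theorem ricciCurv_oneFormDeformation (hU : IsOpen U) (hb : ContDiffOn ℝ ∞ b U) {p : TBundle n}
    (hp : p.1 ∈ U) :
    ricciCurv (oneFormDeformation b) p = (n - 1 : ℝ) * curvForm (dualForm b) p.1 p.2 p.2 := by
  have h1 := apply_eq_sum_single ((curvForm (dualForm b) p.1).flip p.2) p.2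
  simp only [ContinuousLinearMap.flip_apply] at h1
  simp only [ricciCurv, Matrix.trace, Matrix.diag_apply, jacobiEndo_oneFormDeformation hU hb hp,
    Finset.sum_sub_distrib, Matrix.one_apply_eq]
  rw [Finset.sum_congr rfl fun i _ => mul_comm _ (p.2 i), ← h1]
  simp
  ring

/-! ### The Euler-Lagrange form and the spray axioms -/

/-- The Euler-Lagrange form is semi-basic, without any homogeneity of `E`. -/
theorem eulerLagrangeForm_eq {S : TBundle n → TBundle n} {E : TBundle n → ℝ} {p : TBundle n}
    (hE : ContDiffAt ℝ 2 E p) (hS : (S p).1 = p.2) (w : TBundle n) :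
    eulerLagrangeForm S E p w =
      fderiv ℝ (fderiv ℝ E) p (S p) (0, w.1) - fderiv ℝ E p (w.1, 0) := by
  have hθ : ∀ v u, fderiv ℝ (dJ E) p v u = fderiv ℝ (fderiv ℝ E) p v (0, u.1) := by
    intro v u
    have h1 := hE.hasFDerivAt_fderiv.clm_comp (hasFDerivAt_const (almostTangent n) p)
    have h2 : fderiv ℝ (dJ E) p = _ := h1.fderiv
    rw [h2]
    simp [almostTangent]
  have hd1 : DifferentiableAt ℝ E p := hE.differentiableAt (by norm_num)
  have hd2 : DifferentiableAt ℝ (fun q : TBundle n => fderiv ℝ E q (liouville q)) p := by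
    have h2 : DifferentiableAt ℝ (fun q : TBundle n => ((0 : Vec n), q.2)) p := by fun_prop
    exact hE.hasFDerivAt_fderiv.differentiableAt.clm_apply h2
  have hf : fderiv ℝ (fun q => E q - fderiv ℝ E q (liouville q)) p w =
      fderiv ℝ E p w - (fderiv ℝ (fderiv ℝ E) p w (0, p.2) + fderiv ℝ E p (0, w.2)) :=
    fderiv_apply_of_hasLineDerivAt (hd1.sub hd2)
      ((hE.hasLineDerivAt_self w).sub_real (hE.hasLineDerivAt_fderiv_fibre w))
  rw [eulerLagrangeForm, extD, hθ, hθ, hf, hS]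
  have h3 := fderiv_apply_split E p w.1 w.2
  simp only [Prod.mk.eta] at h3
  rw [h3]
  ring

theorem isSpray_oneFormDeformation (hU : IsOpen U) (hb : ContDiffOn ℝ ∞ b U) :
    IsSpray U (oneFormDeformation b) := by
  have hS : oneFormDeformation b = fun p => (p.2, -(2 * dualForm b p.1 p.2) • p.2) :=
    funext (oneFormDeformation_eq b)
  have h1 : ContDiffOn ℝ ∞ (fun p : TBundle n => dualForm b p.1) (slitBundle U) :=
    (contDiffOn_dualForm hb).comp contDiff_fst.contDiffOn (fun p hp => hp.1)
  have h2 : ContDiffOn ℝ ∞ (fun p : TBundle n => dualForm b p.1 p.2) (slitBundle U) :=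
    h1.clm_apply contDiff_snd.contDiffOn
  refine ⟨?_, ?_, ?_⟩
  · rw [hS]
    exact contDiff_snd.contDiffOn.prodMk
      ((contDiffOn_const.mul h2).neg.smul contDiff_snd.contDiffOn)
  · intro p _
    rw [oneFormDeformation_eq]
    simp [almostTangent, liouville]
  · intro p hp
    have hB := ((contDiffOn_dualForm hb).contDiffAt_two hU hp.1).differentiableAt (by norm_num)
    have hL : HasFDerivAt (liouville : TBundle n → TBundle n)
        ((ContinuousLinearMap.inr ℝ (Vec n) (Vec n)).comp
          (ContinuousLinearMap.snd ℝ (Vec n) (Vec n))) p :=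
      ((ContinuousLinearMap.inr ℝ (Vec n) (Vec n)).comp
        (ContinuousLinearMap.snd ℝ (Vec n) (Vec n))).hasFDerivAt
    have hβ := hB.hasFDerivAt.comp_prod_fst.clm_apply (hasFDerivAt_snd (p := p))
    have hsnd := hasFDerivAt_snd (𝕜 := ℝ) (E := Vec n) (F := Vec n) (p := p)
    have hSd := hsnd.prodMk ((hβ.const_mul 2).neg.smul hsnd)
    have hSd' : HasFDerivAt (oneFormDeformation b) _ p := hSd.congr_of_eventuallyEq
      (Eventually.of_forall (oneFormDeformation_eq b))
    rw [VectorField.lieBracket, hL.fderiv, hSd'.fderiv, oneFormDeformation_eq]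
    ext i <;> simp [liouville]
end Coordinates

section Conclusion

variable {n : ℕ} {U : Set (Vec n)} {b : Vec n → Vec n}

/-! ### From a Finsler function to the quadratic function -/

theorem hasQuadraticForm_of_closed_of_parallel (hU : IsOpen U) (hUc : IsConnected U)
    (hb : ContDiffOn ℝ ∞ b U)
    (hcl : ∀ x ∈ U, ∀ u v, fderiv ℝ (dualForm b) x u v = fderiv ℝ (dualForm b) x v u)
    (hpar : ∀ x ∈ U, IsDeformParallelAt (dualForm b) x) : HasQuadraticForm U b := by
  obtain ⟨x₀, hx₀⟩ := hUc.nonempty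
  have hglob := fun x hx => osculatingQuad_global hU hUc.isPreconnected (contDiffOn_dualForm hb)
    hcl hpar hx₀ (x := x) hx
  set β := dualForm b x₀
  let M : Vec n →L[ℝ] Vec n →L[ℝ] ℝ := β.smulRight β + deformForm (dualForm b) x₀
  have hM : ∀ u v, M u v = β u * β v + deformForm (dualForm b) x₀ u v := by
    intro u v
    simp [M]
  have hMs : ∀ u v, M u v = M v u := by
    intro u v
    rw [hM, hM, deformForm_symm (hcl x₀ hx₀) u v]
    ring
  -- expanding the osculating quadratic function at `x₀` in powers of `x`
  let C : Matrix (Fin n) (Fin n) ℝ := Matrix.of fun i j => M (Pi.single i 1) (Pi.single j 1)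
  let c' : Vec n := fun k => -2 * β (Pi.single k 1) - 2 * M x₀ (Pi.single k 1)
  let c : ℝ := 1 + 2 * β x₀ + M x₀ x₀
  have hquad : ∀ x, quadFun C c' c x = osculatingQuad (dualForm b) x₀ x := by
    intro x
    have h1 : ∑ i, ∑ j, C i j * x i * x j = M x x := (bilin_eq_sum_single M x x).symm
    have h2 : ∑ i, c' i * x i = -2 * β x - 2 * M x₀ x := by
      rw [apply_eq_sum_single β x, apply_eq_sum_single (M x₀) x, Finset.mul_sum, Finset.mul_sum,
        ← Finset.sum_sub_distrib]
      exact Finset.sum_congr rfl fun i _ => by simp only [c']; ring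
    have h3 : M (x - x₀) (x - x₀) = M x x - 2 * M x₀ x + M x₀ x₀ := by
      simp only [map_sub, sub_apply, hMs x x₀]
      ring
    rw [quadFun, h1, h2, osculatingQuad]
    have h4 := hM (x - x₀) (x - x₀)
    have h5 : β (x - x₀) = β x - β x₀ := map_sub _ _ _
    change M x x + (-2 * β x - 2 * M x₀ x) + c = 1 - 2 * β (x - x₀) + β (x - x₀) * β (x - x₀)
      + deformForm (dualForm b) x₀ (x - x₀) (x - x₀)
    linear_combination h4 - h3 + 2 * h5
  refine ⟨C, c', c, ?_, ?_, ?_⟩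
  · ext i j
    exact hMs _ _
  · intro x hx
    rw [hquad]
    exact (hglob x hx).1
  · intro x hx k
    have h1 := (hglob x hx).2 (Pi.single k 1)
    rw [dualForm_single] at h1
    have h2 : ∑ i, C i k * x i = M x (Pi.single k 1) := by
      have := apply_eq_sum_single (M.flip (Pi.single k 1)) x
      simp only [ContinuousLinearMap.flip_apply] at this
      rw [this]
      exact Finset.sum_congr rfl fun i _ => mul_comm _ _
    have h3 : M (x - x₀) (Pi.single k 1) = M x (Pi.single k 1) - M x₀ (Pi.single k 1) := by
      simp only [map_sub, sub_apply]
    have h4 := hM (x - x₀) (Pi.single k 1)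
    rw [eq_div_iff (mul_ne_zero two_ne_zero (by rw [hquad]; exact (hglob x hx).1)), hquad, h2]
    change b x k * (2 * osculatingQuad (dualForm b) x₀ x) =
      -(2 * M x (Pi.single k 1) + (-2 * β (Pi.single k 1) - 2 * M x₀ (Pi.single k 1)))
    linear_combination 2 * h1 - 2 * h3 + 2 * h4

theorem IsFinsler.contDiffOn_energy {F : TBundle n → ℝ} (hF : IsFinsler U F) :
    ContDiffOn ℝ ∞ (energy F) (slitBundle U) :=
  (hF.smooth.pow 2).div_const 2

theorem hasQuadraticForm_of_finslerMetrizable (hn : 2 ≤ n) (hU : IsOpen U) (hUc : IsConnected U)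
    (hb : ContDiffOn ℝ ∞ b U) (h : FinslerMetrizable U (oneFormDeformation b)) :
    HasQuadraticForm U b := by
  obtain ⟨F, hF, -, hEL⟩ := h
  have hE := hF.contDiffOn_energy
  have hpos : ∀ p ∈ U ×ˢ ({0}ᶜ : Set (Vec n)), 0 < energy F p := fun p hp => by
    have := hF.pos p hp
    rw [energy]
    positivity
  have hhom : ∀ p ∈ U ×ˢ ({0}ᶜ : Set (Vec n)), ∀ t : ℝ, 0 < t →
      energy F (p.1, t • p.2) = t ^ 2 * energy F p := fun p hp t ht => by
    rw [energy, energy, hF.homog p hp t ht]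
    ring
  have hB := contDiffOn_dualForm hb
  have hH : IsHorizontallyConstant U (dualForm b) (energy F) := by
    refine isHorizontallyConstant_of_eulerLagrange hU hE hB
      (fun p hp => fderiv_euler_of_homogeneous hU hE hhom hp) fun p hp v => ?_
    have h1 := hEL p hp (v, 0)
    rw [eulerLagrangeForm_eq (hE.contDiffAt_two (isOpen_prod_compl_zero hU) hp)
      (by rw [oneFormDeformation_eq]), oneFormDeformation_eq] at h1
    exact sub_eq_zero.1 h1
  obtain ⟨hcl, hpar⟩ := hH.closed_and_parallel (by rw [Module.finrank_fin_fun]; omega) hU hE hB hpos hhom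
  exact hasQuadraticForm_of_closed_of_parallel hU hUc hb hcl hpar

/-! ### From the quadratic function to a Finsler function -/

theorem HasQuadraticForm.closed_and_parallel (hU : IsOpen U) (hb : ContDiffOn ℝ ∞ b U)
    (h : HasQuadraticForm U b) :
    (∀ x ∈ U, ∀ u v, fderiv ℝ (dualForm b) x u v = fderiv ℝ (dualForm b) x v u) ∧
      ∀ x ∈ U, IsDeformParallelAt (dualForm b) x := by
  obtain ⟨C, c', c, hC, h0, hbk⟩ := h
  let Q : Vec n →L[ℝ] Vec n →L[ℝ] ℝ := ∑ i, ∑ j, C i j •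
    (ContinuousLinearMap.proj (R := ℝ) (φ := fun _ : Fin n => ℝ) i).smulRight
      (ContinuousLinearMap.proj (R := ℝ) (φ := fun _ : Fin n => ℝ) j)
  have hQ : ∀ u v, Q u v = ∑ i, ∑ j, C i j * u i * v j := by
    intro u v
    simp [Q, mul_assoc]
  have hquad : ∀ x, quadFun C c' c x = Q x x + dualForm (fun _ => c') 0 x + c := by
    intro x
    rw [hQ, dualForm_apply, quadFun]
  have hQ2 : ∀ x v, Q x v = ∑ k, (∑ i, C i k * x i) * v k := by
    intro x v
    rw [hQ, Finset.sum_comm]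
    exact Finset.sum_congr rfl fun k _ => by rw [Finset.sum_mul]
  refine closed_and_parallel_of_quadratic hU (contDiffOn_dualForm hb) Q
    (dualForm (fun _ => c') 0) c ?_ ?_ ?_
  · intro u v
    rw [hQ, hQ, Finset.sum_comm]
    refine Finset.sum_congr rfl fun i _ => Finset.sum_congr rfl fun j _ => ?_
    rw [hC.apply]
    ring
  · intro x hx
    rw [← hquad]
    exact h0 x hx
  · intro x hx v
    rw [← hquad, dualForm_apply, dualForm_apply, hQ2, Finset.sum_mul, Finset.mul_sum,
      ← Finset.sum_add_distrib, ← Finset.sum_neg_distrib]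
    refine Finset.sum_congr rfl fun k _ => ?_
    have h1 := h0 x hx
    rw [hbk x hx k]
    field_simp

/-- The Finsler function `√(s a(y, y))`, with a sign `s`. -/
noncomputable def curvFinsler (b : Vec n → Vec n) (s : ℝ) (p : TBundle n) : ℝ :=
  √(s * deformQuad (dualForm b) p)

variable {s : ℝ}

theorem energy_curvFinsler (hs : ∀ p ∈ slitBundle U, 0 < s * deformQuad (dualForm b) p)
    {p : TBundle n} (hp : p ∈ slitBundle U) :
    energy (curvFinsler b s) p = s / 2 * deformQuad (dualForm b) p := by
  rw [energy, curvFinsler, Real.sq_sqrt (hs p hp).le]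
  ring

theorem isOpen_slitBundle (hU : IsOpen U) : IsOpen (slitBundle U) :=
  isOpen_prod_compl_zero hU

theorem contDiffOn_curvFinsler (hU : IsOpen U) (hb : ContDiffOn ℝ ∞ b U)
    (hs : ∀ p ∈ slitBundle U, 0 < s * deformQuad (dualForm b) p) :
    ContDiffOn ℝ ∞ (curvFinsler b s) (slitBundle U) :=
  (contDiffOn_const.mul (contDiffOn_deformQuad hU (contDiffOn_dualForm hb))).sqrt
    fun p hp => (hs p hp).ne'

theorem pdy_energy_curvFinsler (hU : IsOpen U) (hb : ContDiffOn ℝ ∞ b U)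
    (hcl : ∀ x ∈ U, ∀ u v, fderiv ℝ (dualForm b) x u v = fderiv ℝ (dualForm b) x v u)
    (hs : ∀ p ∈ slitBundle U, 0 < s * deformQuad (dualForm b) p)
    {p : TBundle n} (hp : p ∈ slitBundle U) (j : Fin n) :
    pdy j (energy (curvFinsler b s)) p =
      s * deformForm (dualForm b) p.1 (Pi.single j 1) p.2 := by
  have hB := contDiffOn_dualForm hb
  have h1 : energy (curvFinsler b s) =ᶠ[𝓝 p] fun q => s / 2 * deformQuad (dualForm b) q := by
    filter_upwards [(isOpen_slitBundle hU).mem_nhds hp] with q hq using energy_curvFinsler hs hq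
  have hd : DifferentiableAt ℝ (deformQuad (dualForm b)) p :=
    ((contDiffOn_deformQuad hU hB).contDiffAt_two (isOpen_prod_compl_zero hU) hp).differentiableAt
      (by norm_num)
  rw [pdy, h1.fderiv_eq, fderiv_const_mul hd, smul_apply,
    fderiv_deformQuad_apply hU hB hp, deformForm_symm (hcl p.1 hp.1) p.2]
  simp
  ring

theorem metricTensor_curvFinsler (hU : IsOpen U) (hb : ContDiffOn ℝ ∞ b U)
    (hcl : ∀ x ∈ U, ∀ u v, fderiv ℝ (dualForm b) x u v = fderiv ℝ (dualForm b) x v u)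
    (hs : ∀ p ∈ slitBundle U, 0 < s * deformQuad (dualForm b) p)
    {p : TBundle n} (hp : p ∈ slitBundle U) (i j : Fin n) :
    metricTensor (curvFinsler b s) p i j =
      s * deformForm (dualForm b) p.1 (Pi.single j 1) (Pi.single i 1) := by
  have ha := differentiableAt_deformForm hU (contDiffOn_dualForm hb) hp.1
  have h1 : pdy j (energy (curvFinsler b s)) =ᶠ[𝓝 p]
      fun q => s * deformForm (dualForm b) q.1 (Pi.single j 1) q.2 := by
    filter_upwards [(isOpen_slitBundle hU).mem_nhds hp] with q hq
    exact pdy_energy_curvFinsler hU hb hcl hs hq j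
  have hd : DifferentiableAt ℝ (fun q : TBundle n => deformForm (dualForm b) q.1) p :=
    (HasFDerivAt.comp_prod_fst (X := Vec n →L[ℝ] Vec n →L[ℝ] ℝ) (p := p)
      ha.hasFDerivAt).differentiableAt
  have hd2 : DifferentiableAt ℝ
      (fun q : TBundle n => s * deformForm (dualForm b) q.1 (Pi.single j 1) q.2) p :=
    (((hd.clm_apply (differentiableAt_const _)).clm_apply differentiableAt_snd)).const_mul s
  rw [metricTensor, Matrix.of_apply, pdy, h1.fderiv_eq]
  apply fderiv_apply_of_hasLineDerivAt hd2
  simpa using (ha.hasLineDerivAt_bilin_fst_apply_snd (0, Pi.single i 1)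
    (Pi.single j 1)).const_mul_real s

theorem isFinsler_curvFinsler (hU : IsOpen U) (hb : ContDiffOn ℝ ∞ b U)
    (hcl : ∀ x ∈ U, ∀ u v, fderiv ℝ (dualForm b) x u v = fderiv ℝ (dualForm b) x v u)
    (hs : ∀ p ∈ slitBundle U, 0 < s * deformQuad (dualForm b) p) :
    IsFinsler U (curvFinsler b s) where
  smooth := contDiffOn_curvFinsler hU hb hs
  pos p hp := Real.sqrt_pos.2 (hs p hp)
  zero x _ := by simp [curvFinsler, deformQuad]
  homog p hp t ht := by
    rw [curvFinsler, curvFinsler, deformQuad_smul, mul_left_comm,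
      Real.sqrt_mul (sq_nonneg t), Real.sqrt_sq ht.le]
  rank_eq p hp := by
    -- the metric tensor is the definite form `s a`, hence invertible
    have hunit : IsUnit (metricTensor (curvFinsler b s) p) := by
      rw [Matrix.isUnit_iff_isUnit_det, isUnit_iff_ne_zero]
      intro hdet
      obtain ⟨v, hv, hv0⟩ := Matrix.exists_mulVec_eq_zero_iff.2 hdet
      have h1 : ∑ i, v i * (metricTensor (curvFinsler b s) p).mulVec v i =
          s * deformForm (dualForm b) p.1 v v := by
        rw [bilin_eq_sum_single (deformForm (dualForm b) p.1) v v]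
        simp only [Matrix.mulVec, dotProduct, Finset.mul_sum]
        rw [Finset.sum_comm]
        refine Finset.sum_congr rfl fun i _ => Finset.sum_congr rfl fun j _ => ?_
        rw [metricTensor_curvFinsler hU hb hcl hs hp]
        ring
      rw [hv0] at h1
      simp only [Pi.zero_apply, mul_zero, Finset.sum_const_zero] at h1
      exact (hs (p.1, v) ⟨hp.1, hv⟩).ne h1
    rw [Matrix.rank_of_isUnit _ hunit, Fintype.card_fin]

theorem isGeodesicSpray_curvFinsler (hU : IsOpen U) (hb : ContDiffOn ℝ ∞ b U)
    (hcl : ∀ x ∈ U, ∀ u v, fderiv ℝ (dualForm b) x u v = fderiv ℝ (dualForm b) x v u)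
    (hpar : ∀ x ∈ U, IsDeformParallelAt (dualForm b) x)
    (hs : ∀ p ∈ slitBundle U, 0 < s * deformQuad (dualForm b) p) :
    IsGeodesicSpray U (curvFinsler b s) (oneFormDeformation b) := by
  refine ⟨isSpray_oneFormDeformation hU hb, fun p hp w => ?_⟩
  have hB := contDiffOn_dualForm hb
  have hE := (isFinsler_curvFinsler hU hb hcl hs).contDiffOn_energy
  have hhom : ∀ q ∈ slitBundle U, ∀ t : ℝ, 0 < t →
      energy (curvFinsler b s) (q.1, t • q.2) = t ^ 2 * energy (curvFinsler b s) q :=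
    fun q hq t ht => by
      rw [energy, energy, (isFinsler_curvFinsler hU hb hcl hs).homog q hq t ht]
      ring
  have hH := (isHorizontallyConstant_deformQuad hU hB hcl hpar).const_mul hU (s / 2)
    (contDiffOn_deformQuad hU hB) (fun q hq => energy_curvFinsler hs hq)
  rw [eulerLagrangeForm_eq (hE.contDiffAt_two (isOpen_slitBundle hU) hp)
    (by rw [oneFormDeformation_eq]), oneFormDeformation_eq, sub_eq_zero]
  exact hH.eulerLagrange hU hE hB
    (fun q hq => fderiv_euler_of_homogeneous hU hE hhom hq) hp w.1

theorem hasConstFlagCurvature_curvFinsler (hU : IsOpen U) (hb : ContDiffOn ℝ ∞ b U)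
    (hcl : ∀ x ∈ U, ∀ u v, fderiv ℝ (dualForm b) x u v = fderiv ℝ (dualForm b) x v u)
    (hss : s * s = 1) (hs : ∀ p ∈ slitBundle U, 0 < s * deformQuad (dualForm b) p) :
    HasConstFlagCurvature U (curvFinsler b s) (oneFormDeformation b) s := by
  intro p hp i j
  have hF : DifferentiableAt ℝ (curvFinsler b s) p :=
    ((contDiffOn_curvFinsler hU hb hs).contDiffAt_two (isOpen_slitBundle hU) hp).differentiableAt
      (by norm_num)
  -- `F dF = dE`
  have h1 : curvFinsler b s p * pdy j (curvFinsler b s) p =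
      s * deformForm (dualForm b) p.1 (Pi.single j 1) p.2 := by
    rw [← pdy_energy_curvFinsler hU hb hcl hs hp, pdy, pdy]
    have h2 := (hF.hasFDerivAt.hasLineDerivAt (0, Pi.single j 1))
    have hE : DifferentiableAt ℝ (energy (curvFinsler b s)) p :=
      (isFinsler_curvFinsler hU hb hcl hs).contDiffOn_energy.contDiffAt_two (isOpen_slitBundle hU) hp
        |>.differentiableAt (by norm_num)
    refine (fderiv_apply_of_hasLineDerivAt hE ?_).symm
    convert (h2.mul_real h2).const_mul_real (1 / 2) using 1
    · funext q
      rw [energy]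
      ring
    · ring
  have h3 : curvFinsler b s p ^ 2 = s * deformForm (dualForm b) p.1 p.2 p.2 :=
    Real.sq_sqrt (hs p hp).le
  rw [h1, h3, jacobiEndo_oneFormDeformation hU hb hp.1, curvForm_eq_deformForm (hcl p.1 hp.1)]
  linear_combination
    -(deformForm (dualForm b) p.1 p.2 p.2 * (1 : Matrix (Fin n) (Fin n) ℝ) i j
      - deformForm (dualForm b) p.1 (Pi.single j 1) p.2 * p.2 i) * hss

theorem metrizable_of_hasQuadraticForm (hn : 2 ≤ n) (hU : IsOpen U) (hUc : IsConnected U)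
    (hb : ContDiffOn ℝ ∞ b U) (hR : RicciNonvanishing U (oneFormDeformation b))
    (h : HasQuadraticForm U b) : MetrizableNonzeroConstCurvature U (oneFormDeformation b) := by
  obtain ⟨hcl, hpar⟩ := h.closed_and_parallel hU hb
  have hne : ∀ p ∈ U ×ˢ ({0}ᶜ : Set (Vec n)), deformQuad (dualForm b) p ≠ 0 := by
    intro p hp h0
    apply hR p hp
    rw [ricciCurv_oneFormDeformation hU hb hp.1, curvForm_eq_deformForm (hcl p.1 hp.1)]
    exact mul_eq_zero_of_right _ h0
  obtain ⟨s, hs1, hs⟩ := exists_sign_deformQuad (by rw [Module.finrank_fin_fun]; omega) hU hUc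
    (contDiffOn_dualForm hb) hne
  have hss : s * s = 1 := by rcases hs1 with rfl | rfl <;> norm_num
  exact ⟨curvFinsler b s, s, isFinsler_curvFinsler hU hb hcl hs,
    isGeodesicSpray_curvFinsler hU hb hcl hpar hs, left_ne_zero_of_mul (hss ▸ one_ne_zero),
    hasConstFlagCurvature_curvFinsler hU hb hcl hss hs⟩

/-- The Ricci curvature of a Finsler function of constant flag curvature `κ` is
`κ (n - 1) F²`. -/
theorem ricciNonvanishing_of_metrizable (hn : 2 ≤ n) (hU : IsOpen U)
    {S : TBundle n → TBundle n} (h : MetrizableNonzeroConstCurvature U S) :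
    RicciNonvanishing U S := by
  obtain ⟨F, κ, hF, -, hκ, hc⟩ := h
  intro p hp
  have hd : DifferentiableAt ℝ F p :=
    (hF.smooth.contDiffAt_two (isOpen_slitBundle hU) hp).differentiableAt (by norm_num)
  have hhom : ∀ q ∈ slitBundle U, ∀ t : ℝ, 0 < t →
      F (q.1, t • q.2) ^ 2 = t ^ 2 * F q ^ 2 := fun q hq t ht => by
    rw [hF.homog q hq t ht]
    ring
  have h1 := fderiv_euler_of_homogeneous hU (E := fun q => F q ^ 2) (hF.smooth.pow 2) hhom hp
  have h2 : fderiv ℝ (fun q => F q ^ 2) p (0, p.2) = 2 * (F p * fderiv ℝ F p (0, p.2)) := by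
    have h3 := hd.hasFDerivAt.hasLineDerivAt (0, p.2)
    refine fderiv_apply_of_hasLineDerivAt (hd.pow 2) ?_
    convert h3.mul_real h3 using 1
    · funext q
      ring
    · ring
  have h4 : fderiv ℝ F p (0, p.2) = ∑ i, p.2 i * pdy i F p := by
    have := apply_eq_sum_single
      ((fderiv ℝ F p).comp (ContinuousLinearMap.inr ℝ (Vec n) (Vec n))) p.2
    simpa [pdy] using this
  have h5 : ricciCurv S p = κ * ((n - 1) * F p ^ 2) := by
    have h6 : ∀ i, jacobiEndo S p i i = κ * F p ^ 2 - κ * F p * (p.2 i * pdy i F p) := by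
      intro i
      rw [hc p hp i i, Matrix.one_apply_eq]
      ring
    simp only [ricciCurv, Matrix.trace, Matrix.diag_apply, h6, Finset.sum_sub_distrib,
      ← Finset.mul_sum, ← h4]
    simp
    linear_combination (-κ / 2) * (h1 - h2)
  have hn' : (2 : ℝ) ≤ n := by exact_mod_cast hn
  rw [h5]
  exact mul_ne_zero hκ (mul_ne_zero (by linarith) (pow_ne_zero 2 (hF.pos p hp).ne'))

end Conclusion

theorem mainTheorem1 {n : ℕ} (hn : 2 ≤ n) (U : Set (Vec n)) (hU : IsOpen U)
    (hUc : IsConnected U) (b : Vec n → Vec n) (hb : ContDiffOn ℝ ∞ b U) :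
    (RicciNonvanishing U (oneFormDeformation b) →
      (FinslerMetrizable U (oneFormDeformation b) ↔ HasQuadraticForm U b)) ∧
    (MetrizableNonzeroConstCurvature U (oneFormDeformation b) ↔
      RicciNonvanishing U (oneFormDeformation b) ∧ HasQuadraticForm U b) ∧
    (FinslerMetrizable U (oneFormDeformation b) → HasQuadraticForm U b) := by
  have hquad : FinslerMetrizable U (oneFormDeformation b) → HasQuadraticForm U b :=
    hasQuadraticForm_of_finslerMetrizable hn hU hUc hb
  have hweak : MetrizableNonzeroConstCurvature U (oneFormDeformation b) →
      FinslerMetrizable U (oneFormDeformation b) := fun ⟨F, _, hF, hG, _⟩ => ⟨F, hF, hG⟩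
  exact ⟨fun hR => ⟨hquad, fun h => hweak (metrizable_of_hasQuadraticForm hn hU hUc hb hR h)⟩,
    ⟨fun h => ⟨ricciNonvanishing_of_metrizable hn hU h, hquad (hweak h)⟩,
      fun h => metrizable_of_hasQuadraticForm hn hU hUc hb h.1 h.2⟩, hquad⟩
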